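/- All complexes are combinatorial complexes of dimension at most $2$ and all maps are combinatorial (open cells are mapped homeomorphically onto open cells). For a group $H$, an $H$-complex is a complex with a cellular $H$-action without inversions, i.e. every element that stabilizes a cell setwise fixes it pointwise; it is $H$-cocompact if there are finitely many $H$-orbits of cells. The link of a $0$-cell $x$ is the graph whose vertices are the ends of $1$-cells at $x$ and whose edges are the corners of $2$-cells at $x$. An immersion is a locally injective map, i.e. a map whose induced maps on links of $0$-cells are embeddings. A path $P\to Y$ is a map from a subdivided interval or a single $0$-cell; it is essential if its lift to the universal cover $\widetilde Y$ (of the component containing it) is not closed. For an $H$-complex $Y$, let $\partial(H,Y)$ be the set of $H$-orbits of $0$-cells whose link is a single vertex or has a spur (an edge having a vertex of valence one), and let $\mathrm{Isol}(H,Y)$ be the set of $H$-orbits of $0$-cells whose link has at least one vertex of valence zero. **Theorem (Collapsing essential paths).** Let $H$ be a group, let $X$ be a simply-connected $H$-complex, let $Y\to X$ be an $H$-equivariant immersion of $H$-complexes, and let $P\to Y$ be an essential path. Suppose that $P\to Y\to X$ is a closed path that is simple in the sense that it embeds except at its endpoints. Then there are an $H$-complex $Z$ and a factorization of $Y\to X$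 as a composition $Y\to Z\to X$ of $H$-equivariant maps such that $Y\to Z$ is $\pi_1$-surjective (at every base $0$-cell of $Y$), $Z\to X$ is an immersion, and the path $P\to Y\to Z$ is closed and null-homotopic. Moreover, $Z$ can be chosen so that all of the following hold: 1. If $Y$ is connected, then $Z$ is connected. 2. If $Y$ is $H$-cocompact, then $Z$ is $H$-cocompact. 3. $|\partial(H,Z)\cup\mathrm{Isol}(H,Z)|\le|\partial(H,Y)\cup\mathrm{Isol}(H,Y)|$ (as cardinal numbers). -/

import Mathlib

universe u

/-! ## Graphs -/

/-- A graph (possibly with loops and multiple edges): a set of vertices, and a set of oriented edges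
("darts") with a fixed-point free orientation-reversing involution. An (unoriented) edge, or
`1`-cell, is a pair `{d, inv d}`. -/
structure OrientedGraph where
  Vert : Type u
  Dart : Type u
  src : Dart → Vert
  inv : Dart → Dart
  inv_inv : ∀ d, inv (inv d) = d
  inv_ne : ∀ d, inv d ≠ d

namespace OrientedGraph

variable (Γ : OrientedGraph.{u})

/-- The terminal vertex of an oriented edge. -/
def tgt (d : Γ.Dart) : Γ.Vert := Γ.src (Γ.inv d)

/-- The number of ends of edges at a vertex; a loop contributes two. -/
noncomputable def valence (v : Γ.Vert) : ℕ∞ := Set.encard {d : Γ.Dart | Γ.src d = v}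

/-- There is an edge having a vertex of valence one. -/
def HasSpur : Prop := ∃ d : Γ.Dart, Γ.valence (Γ.src d) = 1

/-- There is a vertex of valence zero. -/
def HasIsolatedVertex : Prop := ∃ v : Γ.Vert, Γ.valence v = 0

/-- The graph is a single vertex, without edges. -/
def IsSingleVertex : Prop := (∃ v : Γ.Vert, ∀ w, w = v) ∧ IsEmpty Γ.Dart

/-- The sequence `l` of oriented edges is an edge path from `v` to `w`: a combinatorial map from an
interval subdivided into `l.length` edges (from a single `0`-cell if `l = []`). -/
def IsPath : Γ.Vert → List Γ.Dart → Γ.Vert → Prop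
  | v, [], w => v = w
  | v, d :: l, w => Γ.src d = v ∧ IsPath (Γ.tgt d) l w

/-- A closed path `l` embeds except at its endpoints: the `0`-cells at which its edges start are
distinct, and distinct edges of the domain have distinct image `1`-cells. -/
def IsSimpleClosed (l : List Γ.Dart) : Prop :=
  (∃ v, Γ.IsPath v l v) ∧ (l.map Γ.src).Nodup ∧ l.Pairwise (fun d e => e ≠ d ∧ e ≠ Γ.inv d)

end OrientedGraph

/-! ## Combinatorial 2-complexes -/

/-- A combinatorial complex of dimension at most two: a graph (the `1`-skeleton) together with
`2`-cells, each of which is a polygon with finitely many, at least one, sides, glued to the graph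
along a closed edge path.

The polygons are recorded through their oriented sides: an `n`-gon has `2 * n` of them.
`edge s` is the oriented edge of the `1`-skeleton to which `s` is glued, `next s` is the side that
follows `s` around the polygon in the direction given by `s`, and `rev s` is `s` with the opposite
orientation. The `2`-cells are the orbits of sides under `next` and `rev`; such an orbit consists
of two `next`-cycles of the same finite length, one for each direction around the polygon. -/
structure TwoComplex extends OrientedGraph.{u} where
  Side : Type u
  edge : Side → Dart
  next : Equiv.Perm Side
  rev : Side → Side
  rev_rev : ∀ s, rev (rev s) = s
  edge_rev : ∀ s, edge (rev s) = inv (edge s)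
  src_edge_next : ∀ s, src (edge (next s)) = src (inv (edge s))
  next_rev_next : ∀ s, next (rev (next s)) = rev s
  next_periodic : ∀ s, s ∈ Function.periodicPts next
  not_sameCycle_rev : ∀ s, ¬ next.SameCycle s (rev s)

namespace TwoComplex

variable (C : TwoComplex.{u})

/-- Two oriented sides belong to the same `2`-cell. -/
def SameCell (s t : C.Side) : Prop := C.next.SameCycle s t ∨ C.next.SameCycle (C.rev s) t

/-- The boundary path of the `2`-cell of `s`, starting with the side `s`. -/
noncomputable def boundary (s : C.Side) : List C.Dart :=
  (List.range (Function.minimalPeriod C.next s)).map fun k => C.edge ((C.next ^ k) s)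

theorem next_rev (s : C.Side) : C.next (C.rev s) = C.rev (C.next.symm s) := by
  have h := C.next_rev_next (C.next.symm s)
  rwa [Equiv.apply_symm_apply] at h

theorem next_symm_rev (s : C.Side) : C.next.symm (C.rev s) = C.rev (C.next s) := by
  rw [Equiv.symm_apply_eq, C.next_rev_next]

theorem src_edge_rev_next_symm (s : C.Side) :
    C.src (C.edge (C.rev (C.next.symm s))) = C.src (C.edge s) := by
  have h := C.src_edge_next (C.next.symm s)
  rw [Equiv.apply_symm_apply] at h
  rw [C.edge_rev, h]

/-- The link of a `0`-cell `x`. Its vertices are the ends of `1`-cells at `x`, that is, the oriented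
edges starting at `x`. Its edges are the corners of `2`-cells at `x`; the corner at the initial
point of an oriented side `s` joins the end of `edge s` to the end of the edge of the other side of
the polygon starting at that corner, which is `rev (next⁻¹ s)`. -/
def link (x : C.Vert) : OrientedGraph.{u} where
  Vert := {d : C.Dart // C.src d = x}
  Dart := {s : C.Side // C.src (C.edge s) = x}
  src s := ⟨C.edge s.1, s.2⟩
  inv s := ⟨C.rev (C.next.symm s.1), (C.src_edge_rev_next_symm s.1).trans s.2⟩
  inv_inv s := by
    apply Subtype.ext
    show C.rev (C.next.symm (C.rev (C.next.symm s.1))) = s.1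
    rw [C.next_symm_rev, C.rev_rev, Equiv.apply_symm_apply]
  inv_ne s h := by
    have h1 : C.rev (C.next.symm s.1) = s.1 := congrArg Subtype.val h
    apply C.not_sameCycle_rev (C.next.symm s.1)
    rw [h1]
    exact ⟨1, by simp⟩

/-- Elementary homotopies of edge paths: insertion of a backtrack, or of the boundary path of a
`2`-cell. -/
inductive HomotopyStep : List C.Dart → List C.Dart → Prop
  | backtrack (l₁ l₂ : List C.Dart) (d : C.Dart) :
      HomotopyStep (l₁ ++ l₂) (l₁ ++ [d, C.inv d] ++ l₂)
  | cell (l₁ l₂ : List C.Dart) (s : C.Side) :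
      HomotopyStep (l₁ ++ l₂) (l₁ ++ C.boundary s ++ l₂)

/-- Homotopy relative to the endpoints of edge paths from `v` to `w`: the equivalence relation
generated by elementary homotopies through such paths. -/
def Homotopic (v w : C.Vert) (l l' : List C.Dart) : Prop :=
  C.IsPath v l w ∧ C.IsPath v l' w ∧
    Relation.EqvGen (fun a b => C.IsPath v a w ∧ C.IsPath v b w ∧ C.HomotopyStep a b) l l'

/-- `l` is a closed path at `v` that is homotopic to the constant path. -/
def IsNullHomotopic (v : C.Vert) (l : List C.Dart) : Prop := C.Homotopic v v l []

def IsConnected : Prop := Nonempty C.Vert ∧ ∀ v w, ∃ l, C.IsPath v l w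

def IsSimplyConnected : Prop :=
  C.IsConnected ∧ ∀ v l, C.IsPath v l v → C.IsNullHomotopic v l

/-! ## Combinatorial maps -/

/-- A combinatorial map: it sends each open cell homeomorphically onto an open cell; in particular
the polygon of each `2`-cell is mapped isomorphically to a polygon (`side_injOn`). -/
@[ext]
structure Hom (C D : TwoComplex.{u}) where
  onVert : C.Vert → D.Vert
  onDart : C.Dart → D.Dart
  onSide : C.Side → D.Side
  map_src : ∀ d, D.src (onDart d) = onVert (C.src d)
  map_inv : ∀ d, D.inv (onDart d) = onDart (C.inv d)
  map_edge : ∀ s, D.edge (onSide s) = onDart (C.edge s)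
  map_next : ∀ s, D.next (onSide s) = onSide (C.next s)
  map_rev : ∀ s, D.rev (onSide s) = onSide (C.rev s)
  side_injOn : ∀ s t, C.SameCell s t → onSide s = onSide t → s = t

namespace Hom

variable {A B C : TwoComplex.{u}}

theorem sameCell (f : Hom A B) {s t : A.Side} (h : A.SameCell s t) :
    B.SameCell (f.onSide s) (f.onSide t) := by
  have key : ∀ {s t : A.Side}, A.next.SameCycle s t →
      B.next.SameCycle (f.onSide s) (f.onSide t) := by
    rintro s t ⟨k, rfl⟩
    refine ⟨k, ?_⟩
    have hn : ∀ (n : ℕ) (s : A.Side),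
        (B.next ^ n) (f.onSide s) = f.onSide ((A.next ^ n) s) := by
      intro n
      induction n with
      | zero => intro s; rfl
      | succ n ih => intro s; rw [pow_succ, pow_succ, Equiv.Perm.mul_apply, f.map_next, ih]; rfl
    cases k with
    | ofNat n => simpa using hn n s
    | negSucc n =>
      rw [zpow_negSucc, zpow_negSucc, Equiv.Perm.inv_eq_iff_eq, hn]
      exact congrArg f.onSide (Equiv.apply_symm_apply _ _).symm
  rcases h with h | h
  · exact Or.inl (key h)
  · exact Or.inr (by rw [f.map_rev]; exact key h)

/-- Composition: first `f`, then `g`. -/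
def comp (f : Hom A B) (g : Hom B C) : Hom A C where
  onVert := g.onVert ∘ f.onVert
  onDart := g.onDart ∘ f.onDart
  onSide := g.onSide ∘ f.onSide
  map_src d := by simp [g.map_src, f.map_src]
  map_inv d := by simp [g.map_inv, f.map_inv]
  map_edge s := by simp [g.map_edge, f.map_edge]
  map_next s := by simp [g.map_next, f.map_next]
  map_rev s := by simp [g.map_rev, f.map_rev]
  side_injOn s t h e := f.side_injOn s t h (g.side_injOn _ _ (f.sameCell h) e)

/-- The map induced by `f` from the vertices of the link of `x` to those of the link of `f x`. -/
def linkVert (f : Hom A B) (x : A.Vert) (d : (A.link x).Vert) : (B.link (f.onVert x)).Vert :=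
  ⟨f.onDart d.1, (f.map_src d.1).trans (congrArg f.onVert d.2)⟩

/-- The map induced by `f` from the oriented edges of the link of `x` to those of the link of
`f x`. -/
def linkDart (f : Hom A B) (x : A.Vert) (s : (A.link x).Dart) : (B.link (f.onVert x)).Dart :=
  ⟨f.onSide s.1, by
    rw [f.map_edge, f.map_src]
    exact congrArg f.onVert s.2⟩

/-- `f` is an immersion, i.e. locally injective: the induced maps on links of `0`-cells are
embeddings. -/
def IsImmersion (f : Hom A B) : Prop :=
  ∀ x, Function.Injective (f.linkVert x) ∧ Function.Injective (f.linkDart x)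

/-- `f` is a covering map (of the union of the connected components that it meets): the induced maps
on links of `0`-cells are isomorphisms. -/
def IsCovering (f : Hom A B) : Prop :=
  ∀ x, Function.Bijective (f.linkVert x) ∧ Function.Bijective (f.linkDart x)

/-- `f` induces a surjection from the fundamental group of `A` at `x` to that of `B` at `f x`, for
each `0`-cell `x`: each closed path at `f x` is homotopic to the image of a closed path at `x`. -/
def IsPiOneSurjective (f : Hom A B) : Prop :=
  ∀ x l, B.IsPath (f.onVert x) l (f.onVert x) →
    ∃ l', A.IsPath x l' x ∧ B.Homotopic (f.onVert x) (f.onVert x) (l'.map f.onDart) l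

end Hom

/-- The path `l` starting at `v` is essential: its lifts to the universal cover (of the component
that contains it), a simply-connected covering complex, are not closed. -/
def IsEssential (v : C.Vert) (l : List C.Dart) : Prop :=
  ∀ (U : TwoComplex.{u}) (p : Hom U C), U.IsSimplyConnected → p.IsCovering →
    ∀ (v' w' : U.Vert) (l' : List U.Dart),
      p.onVert v' = v → l'.map p.onDart = l → U.IsPath v' l' w' → v' ≠ w'

end TwoComplex

/-! ## Group actions -/

/-- `C` is a `G`-complex: `G` acts on `C` by combinatorial automorphisms, without inversions, i.e.
an element that stabilizes a cell setwise fixes it pointwise. -/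
class ComplexAction (G : Type u) [Group G] (C : TwoComplex.{u}) where
  actVert : MulAction G C.Vert
  actDart : MulAction G C.Dart
  actSide : MulAction G C.Side
  smul_src : ∀ (g : G) (d : C.Dart), C.src (g • d) = g • C.src d
  smul_inv : ∀ (g : G) (d : C.Dart), C.inv (g • d) = g • C.inv d
  smul_edge : ∀ (g : G) (s : C.Side), C.edge (g • s) = g • C.edge s
  smul_next : ∀ (g : G) (s : C.Side), C.next (g • s) = g • C.next s
  smul_rev : ∀ (g : G) (s : C.Side), C.rev (g • s) = g • C.rev s
  smul_dart_ne_inv : ∀ (g : G) (d : C.Dart), g • d ≠ C.inv d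
  smul_side_eq : ∀ (g : G) (s : C.Side), C.SameCell s (g • s) → g • s = s

attribute [reducible, instance] ComplexAction.actVert ComplexAction.actDart ComplexAction.actSide

namespace TwoComplex

variable (G : Type u) [Group G]

/-- The map `f` commutes with the actions of `G`. -/
def Hom.IsEquivariant {A B : TwoComplex.{u}} [ComplexAction G A] [ComplexAction G B]
    (f : Hom A B) : Prop :=
  (∀ (g : G) (v : A.Vert), f.onVert (g • v) = g • f.onVert v) ∧
  (∀ (g : G) (d : A.Dart), f.onDart (g • d) = g • f.onDart d) ∧
  (∀ (g : G) (s : A.Side), f.onSide (g • s) = g • f.onSide s)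

variable (C : TwoComplex.{u}) [ComplexAction G C]

/-- There are finitely many `G`-orbits of cells. -/
def IsCocompact : Prop :=
  Finite (MulAction.orbitRel.Quotient G C.Vert) ∧ Finite (MulAction.orbitRel.Quotient G C.Dart) ∧
    Finite (MulAction.orbitRel.Quotient G C.Side)

/-- The orbits of `0`-cells whose link is a single vertex or has spurs. -/
def bnd : Set (MulAction.orbitRel.Quotient G C.Vert) :=
  {o | ∃ x : C.Vert, Quotient.mk _ x = o ∧ ((C.link x).IsSingleVertex ∨ (C.link x).HasSpur)}

/-- The orbits of `0`-cells whose link has at least one vertex of valence zero. -/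
def isolated : Set (MulAction.orbitRel.Quotient G C.Vert) :=
  {o | ∃ x : C.Vert, Quotient.mk _ x = o ∧ (C.link x).HasIsolatedVertex}

end TwoComplex

/-! Since `X` is simply connected, the image of `P` contracts in `X`, and a contraction involves
only finitely many edges and `2`-cells. It is lifted to `Y` one elementary homotopy at a time,
enlarging `Y` equivariantly whenever something is missing. A missing edge is attached, with all its
translates, at a new free endpoint (`exists_extension_dart`). For a missing `2`-cell, the boundary
path is first lifted to a path from `a` to `b`; then `h • a` is identified with `h • b` for all `h`,
the result is folded so that the map to `X` is again an immersion, and the orbit of the cell is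
added (`exists_extension_side_of_isPath`). New free edges create no new homotopy classes of loops.
Identifying `a` with `b` creates none either, because the path joining them becomes the boundary of
the new cell, and folding identifies only points joined by paths with null-homotopic image. So every
enlargement is `π₁`-surjective and adds finitely many orbits of cells: it is an `IsFiniteExtension`.
Unique lifting along immersions fits the pieces together (`exists_extension_homotopic`).

For the bound on boundary and isolated orbits, choose a finite extension killing `P` in which the
edges outside the image of `Y` are covered by the translates of as few edges as possible. If a new
edge lay on at most one side of a `2`-cell, its orbit could be deleted: either by collapsing
`2`-cells through free faces, or by dropping edges that lie in no `2`-cell. Both deletions are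
faithful on homotopy classes of paths, as a retraction of edge paths shows (`removeEdge_homotopic`),
so the smaller complex would still be an extension killing `P`. Hence every new edge lies on at
least two sides (`exists_extension_thick`).

An orbit belongs to the union of the two sets exactly when some end of a `1`-cell there lies in at
most one corner (`mem_bnd_union_isolated`). In the minimal extension such an edge comes from `Y`,
and it lies in at most one corner there too because `Y → X` is an immersion. So the orbits counted
in `Z` are images of orbits counted in `Y`. Deletion may leave components disjoint from the image of
`Y`; keeping only the components that meet the image restores connectedness. -/

/-! ## Edge paths -/

namespace OrientedGraph

variable {Γ : OrientedGraph.{u}}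

@[simp] theorem src_inv (d : Γ.Dart) : Γ.src (Γ.inv d) = Γ.tgt d := rfl

@[simp] theorem tgt_inv (d : Γ.Dart) : Γ.tgt (Γ.inv d) = Γ.src d := by
  simp [tgt, Γ.inv_inv]

@[simp] theorem isPath_nil {v w : Γ.Vert} : Γ.IsPath v [] w ↔ v = w := Iff.rfl

@[simp] theorem isPath_cons {v w : Γ.Vert} {d : Γ.Dart} {l : List Γ.Dart} :
    Γ.IsPath v (d :: l) w ↔ Γ.src d = v ∧ Γ.IsPath (Γ.tgt d) l w := Iff.rfl

theorem isPath_append {v w : Γ.Vert} {l m : List Γ.Dart} :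
    Γ.IsPath v (l ++ m) w ↔ ∃ x, Γ.IsPath v l x ∧ Γ.IsPath x m w := by
  induction l generalizing v with
  | nil => simp
  | cons d l ih => simp [ih, and_assoc]

theorem IsPath.append {v w x : Γ.Vert} {l m : List Γ.Dart} (hl : Γ.IsPath v l w)
    (hm : Γ.IsPath w m x) : Γ.IsPath v (l ++ m) x := isPath_append.2 ⟨w, hl, hm⟩

theorem isPath_singleton (d : Γ.Dart) : Γ.IsPath (Γ.src d) [d] (Γ.tgt d) := by simp

theorem IsPath.target_unique {v w x : Γ.Vert} {l : List Γ.Dart} (h : Γ.IsPath v l w)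
    (h' : Γ.IsPath v l x) : w = x := by
  induction l generalizing v with
  | nil => exact h.symm.trans h'
  | cons d l ih => exact ih h.2 h'.2

/-- The inverse of an edge path. -/
def invPath (Γ : OrientedGraph.{u}) (l : List Γ.Dart) : List Γ.Dart := (l.map Γ.inv).reverse

@[simp] theorem invPath_nil : Γ.invPath [] = [] := rfl

@[simp] theorem invPath_cons (d : Γ.Dart) (l : List Γ.Dart) :
    Γ.invPath (d :: l) = Γ.invPath l ++ [Γ.inv d] := by simp [invPath]

@[simp] theorem invPath_append (l m : List Γ.Dart) :
    Γ.invPath (l ++ m) = Γ.invPath m ++ Γ.invPath l := by simp [invPath]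

@[simp] theorem invPath_invPath (l : List Γ.Dart) : Γ.invPath (Γ.invPath l) = l := by
  have : Γ.inv ∘ Γ.inv = id := funext Γ.inv_inv
  simp [invPath, this]

theorem IsPath.inv {v w : Γ.Vert} {l : List Γ.Dart} (h : Γ.IsPath v l w) :
    Γ.IsPath w (Γ.invPath l) v := by
  induction l generalizing v with
  | nil => exact Eq.symm h
  | cons d l ih =>
    rw [invPath_cons]
    exact (ih h.2).append ⟨rfl, by simpa using h.1⟩

theorem isPath_map_range {c : ℕ → Γ.Dart} (n : ℕ) (h : ∀ i < n, Γ.src (c (i + 1)) = Γ.tgt (c i)) :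
    Γ.IsPath (Γ.src (c 0)) ((List.range n).map c) (Γ.src (c n)) := by
  induction n with
  | zero => rfl
  | succ n ih =>
    rw [List.range_succ, List.map_append]
    exact (ih fun i hi => h i (by omega)).append ⟨rfl, (h n (by omega)).symm⟩

theorem IsPath.src_getElem {v w : Γ.Vert} {l : List Γ.Dart} (h : Γ.IsPath v l w) (i : ℕ)
    (hi : i + 1 < l.length) : Γ.src l[i + 1] = Γ.tgt l[i] := by
  induction l generalizing v i with
  | nil => simp at hi
  | cons d l ih =>
    cases i with
    | zero =>
      cases l with
      | nil => simp at hi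
      | cons e l => exact h.2.1
    | succ i => exact ih h.2 i (by simpa using hi)

theorem IsPath.src_getElem_zero {v w : Γ.Vert} {l : List Γ.Dart} (h : Γ.IsPath v l w)
    (hl : 0 < l.length) : Γ.src l[0] = v := by
  cases l with
  | nil => simp at hl
  | cons e l => exact h.1

theorem IsPath.tgt_getElem_last {v w : Γ.Vert} {l : List Γ.Dart} (h : Γ.IsPath v l w) (i : ℕ)
    (hi : i + 1 = l.length) : Γ.tgt (l[i]'(by omega)) = w := by
  induction l generalizing v i with
  | nil => simp at hi
  | cons d l ih =>
    cases i with
    | zero =>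
      cases l with
      | nil => exact h.2
      | cons e l => simp at hi
    | succ i => exact ih h.2 i (by simpa using hi)

end OrientedGraph

namespace TwoComplex

open OrientedGraph

variable {C : TwoComplex.{u}}

/-! ## Boundary paths -/

theorem SameCell.refl (s : C.Side) : C.SameCell s s := Or.inl (Equiv.Perm.SameCycle.refl _ _)

theorem SameCell.next {s t : C.Side} (h : C.SameCell s t) : C.SameCell s (C.next t) := by
  rcases h with h | h
  · exact Or.inl (Equiv.Perm.sameCycle_apply_right.2 h)
  · exact Or.inr (Equiv.Perm.sameCycle_apply_right.2 h)

/-- Reversal conjugates `next` to its inverse, so it carries cycles to cycles. -/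
theorem sameCycle_rev {s t : C.Side} (h : C.next.SameCycle s t) :
    C.next.SameCycle (C.rev s) (C.rev t) := by
  obtain ⟨i, rfl⟩ := h
  have key : ∀ (n : ℕ) (s : C.Side), C.next.SameCycle (C.rev s) (C.rev ((C.next ^ n) s)) := by
    intro n
    induction n with
    | zero => intro s; exact Equiv.Perm.SameCycle.refl _ _
    | succ n ih =>
      intro s
      refine (ih s).trans ?_
      rw [pow_succ', Equiv.Perm.mul_apply]
      conv_lhs => rw [← C.next_rev_next]
      exact Equiv.Perm.sameCycle_apply_left.2 (Equiv.Perm.SameCycle.refl _ _)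
  cases i with
  | ofNat n => exact key n s
  | negSucc n =>
    have := key (n + 1) ((C.next ^ (Int.negSucc n)) s)
    have h : (C.next ^ (n + 1)) ((C.next ^ (Int.negSucc n)) s) = s := by
      rw [zpow_negSucc, ← Equiv.Perm.mul_apply, mul_inv_cancel, Equiv.Perm.one_apply]
    rw [h] at this
    exact this.symm

theorem SameCell.rev {s t : C.Side} (h : C.SameCell s t) : C.SameCell s (C.rev t) := by
  rcases h with h | h
  · exact Or.inr (sameCycle_rev h)
  · refine Or.inl ?_
    have := sameCycle_rev h
    rwa [C.rev_rev] at this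

theorem SameCell.symm {s t : C.Side} (h : C.SameCell s t) : C.SameCell t s := by
  rcases h with h | h
  · exact Or.inl h.symm
  · refine Or.inr ?_
    have := sameCycle_rev h.symm
    rwa [C.rev_rev] at this

/-- A property of sides that is inherited by the next and by the reversed side is a property of
whole `2`-cells. -/
theorem SameCell.induction {p : C.Side → Prop} {s t : C.Side} (h : C.SameCell s t) (hs : p s)
    (hnext : ∀ s, p s → p (C.next s)) (hrev : ∀ s, p s → p (C.rev s)) : p t := by
  have key : ∀ {s t : C.Side}, C.next.SameCycle s t → p s → p t := by
    rintro s t ⟨i, rfl⟩ hs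
    have hn : ∀ (n : ℕ) (s : C.Side), p s → p ((C.next ^ n) s) := by
      intro n
      induction n with
      | zero => exact fun s hs => hs
      | succ n ih =>
        intro s hs
        rw [pow_succ', Equiv.Perm.mul_apply]
        exact hnext _ (ih s hs)
    have hsymm : ∀ s, p s → p (C.next.symm s) := by
      intro s hs
      have := hrev _ (hnext _ (hrev _ hs))
      rwa [← C.next_symm_rev, C.rev_rev] at this
    cases i with
    | ofNat n => exact hn n s hs
    | negSucc n =>
      rw [zpow_negSucc, ← inv_pow]
      generalize n + 1 = m
      induction m generalizing s with
      | zero => exact hs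
      | succ m ih =>
        rw [pow_succ, Equiv.Perm.mul_apply]
        exact ih (hsymm s hs)
  rcases h with h | h
  · exact key h hs
  · exact key h (hrev _ hs)

theorem SameCell.trans {s t r : C.Side} (h : C.SameCell s t) (h' : C.SameCell t r) :
    C.SameCell s r :=
  SameCell.induction (p := fun r => C.SameCell s r) h' h (fun _ => SameCell.next)
    (fun _ => SameCell.rev)

theorem minimalPeriod_pos (s : C.Side) : 0 < Function.minimalPeriod C.next s :=
  Function.minimalPeriod_pos_of_mem_periodicPts (C.next_periodic s)

theorem next_pow_minimalPeriod (s : C.Side) :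
    (C.next ^ Function.minimalPeriod C.next s) s = s := by
  rw [← Equiv.Perm.iterate_eq_pow]
  exact Function.iterate_minimalPeriod

theorem minimalPeriod_next (s : C.Side) :
    Function.minimalPeriod C.next (C.next s) = Function.minimalPeriod C.next s :=
  Function.minimalPeriod_apply (C.next_periodic s)

theorem rev_next_pow (s : C.Side) (n : ℕ) :
    (C.next ^ n) (C.rev ((C.next ^ n) s)) = C.rev s := by
  induction n generalizing s with
  | zero => rfl
  | succ n ih =>
    have h1 : ∀ t, (C.next ^ (n + 1)) t = (C.next ^ n) (C.next t) := fun t => by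
      rw [pow_succ, Equiv.Perm.mul_apply]
    have h2 : (C.next ^ (n + 1)) s = C.next ((C.next ^ n) s) := by
      rw [pow_succ', Equiv.Perm.mul_apply]
    rw [h1, h2, C.next_rev_next, ih]

theorem minimalPeriod_rev (s : C.Side) :
    Function.minimalPeriod C.next (C.rev s) = Function.minimalPeriod C.next s := by
  have key : ∀ s : C.Side,
      Function.minimalPeriod C.next (C.rev s) ∣ Function.minimalPeriod C.next s := by
    intro s
    apply Function.IsPeriodicPt.minimalPeriod_dvd
    have h := rev_next_pow s (Function.minimalPeriod C.next s)
    rw [next_pow_minimalPeriod] at h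
    rw [Function.IsPeriodicPt, Function.IsFixedPt, Equiv.Perm.iterate_eq_pow]
    exact h
  refine Nat.dvd_antisymm (key s) ?_
  have := key (C.rev s)
  rwa [C.rev_rev] at this

theorem boundary_eq_cons (s : C.Side) :
    C.boundary s = C.edge s ::
      (List.range (Function.minimalPeriod C.next s - 1)).map fun k => C.edge ((C.next ^ (k + 1)) s)
    := by
  have h := minimalPeriod_pos s
  obtain ⟨n, hn⟩ := Nat.exists_eq_succ_of_ne_zero h.ne'
  rw [boundary, hn, List.range_succ_eq_map]
  simp [Function.comp_def]

/-- Moving the starting corner by one side conjugates the boundary path by one edge. This is what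
transports null-homotopies around a polygon. -/
theorem edge_cons_boundary_next (s : C.Side) :
    C.edge s :: C.boundary (C.next s) = C.boundary s ++ [C.edge s] := by
  have h1 : C.boundary s ++ [C.edge s] =
      (List.range (Function.minimalPeriod C.next s + 1)).map fun k => C.edge ((C.next ^ k) s) := by
    rw [List.range_succ, List.map_append, List.map_singleton, next_pow_minimalPeriod]
    rfl
  rw [h1, List.range_succ_eq_map, boundary, minimalPeriod_next]
  simp [Function.comp_def, pow_succ]

/-- The side `rev s` starts where `s` ends, which is the starting corner of `next s`; hence the
shift by one. -/
theorem boundary_rev (s : C.Side) :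
    C.boundary (C.rev s) = C.invPath (C.boundary (C.next s)) := by
  apply List.ext_getElem
  · simp [boundary, invPath, minimalPeriod_rev, minimalPeriod_next]
  · intro i h1 h2
    simp only [boundary, List.length_map, List.length_range, minimalPeriod_rev] at h1
    simp only [boundary, invPath, List.getElem_map, List.getElem_range, List.getElem_reverse,
      List.length_map, List.length_range, minimalPeriod_next]
    rw [← C.edge_rev]
    congr 1
    generalize hn : Function.minimalPeriod C.next s = n at *
    have h3 : (C.next ^ (n - 1 - i)) (C.next s) = (C.next ^ (n - i)) s := by
      rw [← Equiv.Perm.mul_apply, ← pow_succ]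
      congr 2
      omega
    rw [h3]
    have h4 := rev_next_pow s (n - i)
    rw [← h4, ← Equiv.Perm.mul_apply, ← pow_add]
    have h5 : i + (n - i) = n := by omega
    rw [h5]
    have h6 : Function.minimalPeriod C.next (C.rev ((C.next ^ (n - i)) s)) =
        Function.minimalPeriod C.next s := by
      rw [minimalPeriod_rev, ← Equiv.Perm.iterate_eq_pow,
        Function.minimalPeriod_apply_iterate (C.next_periodic s)]
    have h7 := next_pow_minimalPeriod (C.rev ((C.next ^ (n - i)) s))
    rwa [h6, hn] at h7

theorem isPath_boundary (s : C.Side) :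
    C.IsPath (C.src (C.edge s)) (C.boundary s) (C.src (C.edge s)) := by
  have h := isPath_map_range (Γ := C.toOrientedGraph) (c := fun k => C.edge ((C.next ^ k) s))
    (Function.minimalPeriod C.next s) (fun i _ => by
      rw [pow_succ', Equiv.Perm.mul_apply, C.src_edge_next]
      rfl)
  rw [next_pow_minimalPeriod] at h
  exact h

/-! ## Homotopy of edge paths -/

theorem Homotopic.refl {v w : C.Vert} {l : List C.Dart} (h : C.IsPath v l w) :
    C.Homotopic v w l l := ⟨h, h, .refl _⟩

theorem Homotopic.symm {v w : C.Vert} {l m : List C.Dart} (h : C.Homotopic v w l m) :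
    C.Homotopic v w m l := ⟨h.2.1, h.1, h.2.2.symm⟩

theorem Homotopic.trans {v w : C.Vert} {l m n : List C.Dart} (h : C.Homotopic v w l m)
    (h' : C.Homotopic v w m n) : C.Homotopic v w l n := ⟨h.1, h'.2.1, h.2.2.trans _ _ _ h'.2.2⟩

theorem Homotopic.of_step {v w : C.Vert} {l m : List C.Dart} (hl : C.IsPath v l w)
    (hm : C.IsPath v m w) (h : C.HomotopyStep l m) : C.Homotopic v w l m :=
  ⟨hl, hm, .rel _ _ ⟨hl, hm, h⟩⟩

theorem HomotopyStep.append {l m : List C.Dart} (h : C.HomotopyStep l m) (a b : List C.Dart) :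
    C.HomotopyStep (a ++ l ++ b) (a ++ m ++ b) := by
  rcases h with ⟨l₁, l₂, d⟩ | ⟨l₁, l₂, s⟩
  · simpa using HomotopyStep.backtrack (a ++ l₁) (l₂ ++ b) d
  · simpa using HomotopyStep.cell (a ++ l₁) (l₂ ++ b) s

/-- To prove that a relation contains homotopy, it suffices to consider elementary homotopies. -/
theorem Homotopic.induction {v w : C.Vert} {r : List C.Dart → List C.Dart → Prop}
    {l m : List C.Dart} (h : C.Homotopic v w l m)
    (hstep : ∀ l m, C.IsPath v l w → C.IsPath v m w → C.HomotopyStep l m → r l m)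
    (hrefl : ∀ l, C.IsPath v l w → r l l) (hsymm : ∀ l m, r l m → r m l)
    (htrans : ∀ l m n, r l m → r m n → r l n) : r l m := by
  obtain ⟨hl, hm, h⟩ := h
  -- Intermediate lists in `EqvGen` are not known to be paths from `v` to `w`, so this property is
  -- carried along the chain from the endpoint where it is known.
  have key : (C.IsPath v l w ↔ C.IsPath v m w) ∧ (C.IsPath v l w → r l m) := by
    clear hl hm
    induction h with
    | rel l m h => exact ⟨⟨fun _ => h.2.1, fun _ => h.1⟩, fun _ => hstep l m h.1 h.2.1 h.2.2⟩
    | refl l => exact ⟨Iff.rfl, hrefl l⟩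
    | symm l m _ ih => exact ⟨ih.1.symm, fun h => hsymm _ _ (ih.2 (ih.1.2 h))⟩
    | trans l m n _ _ ih ih' =>
      exact ⟨ih.1.trans ih'.1, fun h => htrans _ _ _ (ih.2 h) (ih'.2 (ih.1.1 h))⟩
  exact key.2 hl

theorem Homotopic.append_both {v w x y : C.Vert} {l m a b : List C.Dart}
    (h : C.Homotopic v w l m) (ha : C.IsPath x a v) (hb : C.IsPath w b y) :
    C.Homotopic x y (a ++ l ++ b) (a ++ m ++ b) := by
  refine h.induction (r := fun l m => C.Homotopic x y (a ++ l ++ b) (a ++ m ++ b)) ?_ ?_ ?_ ?_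
  · exact fun l m hl hm hs => .of_step ((ha.append hl).append hb) ((ha.append hm).append hb)
      (hs.append a b)
  · exact fun l hl => .refl ((ha.append hl).append hb)
  · exact fun _ _ => .symm
  · exact fun _ _ _ => .trans

theorem Homotopic.append {v w x : C.Vert} {l l' m m' : List C.Dart} (h : C.Homotopic v w l l')
    (h' : C.Homotopic w x m m') : C.Homotopic v x (l ++ m) (l' ++ m') := by
  have h1 := h.append_both (a := []) (x := v) rfl h'.1
  have h2 := h'.append_both (b := []) (y := x) h.2.1 rfl
  simp only [List.nil_append, List.append_nil] at h1 h2
  exact h1.trans h2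

theorem homotopic_backtrack (d : C.Dart) : C.IsNullHomotopic (C.src d) [d, C.inv d] :=
  .symm (.of_step rfl ⟨rfl, rfl, by simp⟩ (HomotopyStep.backtrack [] [] d))

theorem homotopic_boundary (s : C.Side) : C.IsNullHomotopic (C.src (C.edge s)) (C.boundary s) := by
  refine .symm (.of_step rfl (isPath_boundary s) ?_)
  simpa using HomotopyStep.cell (C := C) [] [] s

theorem append_invPath {v w : C.Vert} {l : List C.Dart} (h : C.IsPath v l w) :
    C.IsNullHomotopic v (l ++ C.invPath l) := by
  induction l generalizing v with
  | nil => exact .refl rfl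
  | cons d l ih =>
    obtain ⟨rfl, h⟩ := h
    have h1 := (ih h).append_both (a := [d]) (b := [C.inv d]) (x := C.src d) (y := C.src d)
      ⟨rfl, rfl⟩ ⟨rfl, by simp⟩
    simp only [List.append_nil] at h1
    have h2 := h1.trans (homotopic_backtrack d)
    rw [IsNullHomotopic]
    simpa using h2

theorem invPath_append {v w : C.Vert} {l : List C.Dart} (h : C.IsPath v l w) :
    C.IsNullHomotopic w (C.invPath l ++ l) := by
  have := append_invPath h.inv
  rwa [invPath_invPath] at this

/-- Cancellation on the left. -/
theorem Homotopic.cancel_left {u v w : C.Vert} {a l m : List C.Dart} (ha : C.IsPath u a v)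
    (hl : C.IsPath v l w) (hm : C.IsPath v m w) (h : C.Homotopic u w (a ++ l) (a ++ m)) :
    C.Homotopic v w l m := by
  have key : ∀ l, C.IsPath v l w → C.Homotopic v w (C.invPath a ++ (a ++ l)) l := by
    intro l hl
    have := (invPath_append ha).append (Homotopic.refl hl)
    simpa using this
  exact (key l hl).symm.trans (((Homotopic.refl ha.inv).append h).trans (key m hm))

theorem Homotopic.inv {v w : C.Vert} {l m : List C.Dart} (h : C.Homotopic v w l m) :
    C.Homotopic w v (C.invPath l) (C.invPath m) := by
  refine .cancel_left h.1 h.1.inv h.2.1.inv ?_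
  refine (append_invPath h.1).trans ?_
  exact (h.append (.refl h.2.1.inv)).trans (append_invPath h.2.1) |>.symm

/-! ## Combinatorial maps -/

namespace Hom

variable {A B : TwoComplex.{u}} (f : Hom A B)

theorem map_tgt (d : A.Dart) : B.tgt (f.onDart d) = f.onVert (A.tgt d) := by
  rw [tgt, f.map_inv, f.map_src]; rfl

theorem isPath_map {v w : A.Vert} {l : List A.Dart} (h : A.IsPath v l w) :
    B.IsPath (f.onVert v) (l.map f.onDart) (f.onVert w) := by
  induction l generalizing v with
  | nil => exact congrArg _ h
  | cons d l ih =>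
    obtain ⟨rfl, h⟩ := h
    exact ⟨f.map_src d, by rw [map_tgt]; exact ih h⟩

theorem invPath_map (l : List A.Dart) :
    B.invPath (l.map f.onDart) = (A.invPath l).map f.onDart := by
  simp [invPath, Function.comp_def, f.map_inv]

theorem next_pow_map (n : ℕ) (s : A.Side) :
    (B.next ^ n) (f.onSide s) = f.onSide ((A.next ^ n) s) := by
  induction n with
  | zero => rfl
  | succ n ih => rw [pow_succ', pow_succ', Equiv.Perm.mul_apply, ih, f.map_next]; rfl

/-- Injectivity on each `2`-cell prevents a polygon from wrapping several times around its image. -/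
theorem minimalPeriod_map (s : A.Side) :
    Function.minimalPeriod B.next (f.onSide s) = Function.minimalPeriod A.next s := by
  apply Nat.dvd_antisymm
  · apply Function.IsPeriodicPt.minimalPeriod_dvd
    rw [Function.IsPeriodicPt, Function.IsFixedPt, Equiv.Perm.iterate_eq_pow, next_pow_map,
      next_pow_minimalPeriod]
  · apply Function.IsPeriodicPt.minimalPeriod_dvd
    rw [Function.IsPeriodicPt, Function.IsFixedPt, Equiv.Perm.iterate_eq_pow]
    symm
    apply f.side_injOn
    · exact Or.inl ⟨Function.minimalPeriod B.next (f.onSide s), by rw [zpow_natCast]⟩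
    · rw [← next_pow_map, next_pow_minimalPeriod]

theorem boundary_map (s : A.Side) :
    B.boundary (f.onSide s) = (A.boundary s).map f.onDart := by
  simp [boundary, minimalPeriod_map, next_pow_map, f.map_edge]

theorem homotopyStep_map {l m : List A.Dart} (h : A.HomotopyStep l m) :
    B.HomotopyStep (l.map f.onDart) (m.map f.onDart) := by
  rcases h with ⟨l₁, l₂, d⟩ | ⟨l₁, l₂, s⟩
  · simpa [f.map_inv] using
      HomotopyStep.backtrack (l₁.map f.onDart) (l₂.map f.onDart) (f.onDart d)
  · simpa [boundary_map] using
      HomotopyStep.cell (l₁.map f.onDart) (l₂.map f.onDart) (f.onSide s)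

theorem homotopic_map {v w : A.Vert} {l m : List A.Dart} (h : A.Homotopic v w l m) :
    B.Homotopic (f.onVert v) (f.onVert w) (l.map f.onDart) (m.map f.onDart) := by
  refine h.induction (r := fun l m => B.Homotopic (f.onVert v) (f.onVert w) (l.map f.onDart)
    (m.map f.onDart)) ?_ ?_ ?_ ?_
  · exact fun l m hl hm hs => .of_step (f.isPath_map hl) (f.isPath_map hm) (f.homotopyStep_map hs)
  · exact fun l hl => .refl (f.isPath_map hl)
  · exact fun _ _ => .symm
  · exact fun _ _ _ => .trans

variable {f}

theorem isImmersion_iff : f.IsImmersion ↔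
    (∀ d e, A.src d = A.src e → f.onDart d = f.onDart e → d = e) ∧
    (∀ s t, A.src (A.edge s) = A.src (A.edge t) → f.onSide s = f.onSide t → s = t) := by
  constructor
  · intro h
    refine ⟨fun d e hd he => ?_, fun s t hs ht => ?_⟩
    · have := (h (A.src e)).1 (a₁ := ⟨d, hd⟩) (a₂ := ⟨e, rfl⟩) (Subtype.ext he)
      exact congrArg Subtype.val this
    · have := (h (A.src (A.edge t))).2 (a₁ := ⟨s, hs⟩) (a₂ := ⟨t, rfl⟩) (Subtype.ext ht)
      exact congrArg Subtype.val this
  · rintro ⟨h1, h2⟩ x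
    refine ⟨fun d e h => ?_, fun s t h => ?_⟩
    · exact Subtype.ext (h1 _ _ (d.2.trans e.2.symm) (congrArg Subtype.val h))
    · exact Subtype.ext (h2 _ _ (s.2.trans t.2.symm) (congrArg Subtype.val h))

theorem IsImmersion.dart_inj (h : f.IsImmersion) {d e : A.Dart} (h1 : A.src d = A.src e)
    (h2 : f.onDart d = f.onDart e) : d = e := (isImmersion_iff.1 h).1 d e h1 h2

theorem IsImmersion.side_inj (h : f.IsImmersion) {s t : A.Side}
    (h1 : A.src (A.edge s) = A.src (A.edge t)) (h2 : f.onSide s = f.onSide t) : s = t :=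
  (isImmersion_iff.1 h).2 s t h1 h2

/-- Lifts of paths along an immersion are unique. -/
theorem IsImmersion.path_inj (h : f.IsImmersion) {v w w' : A.Vert} {l l' : List A.Dart}
    (hl : A.IsPath v l w) (hl' : A.IsPath v l' w') (e : l.map f.onDart = l'.map f.onDart) :
    l = l' := by
  induction l generalizing v l' with
  | nil => cases l' with
    | nil => rfl
    | cons d l' => simp at e
  | cons d l ih => cases l' with
    | nil => simp at e
    | cons d' l' =>
      simp only [List.map_cons, List.cons.injEq] at e
      obtain rfl : d = d' := h.dart_inj (hl.1.trans hl'.1.symm) e.1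
      rw [ih hl.2 hl'.2 e.2]

theorem IsPiOneSurjective.comp {D : TwoComplex.{u}} {g : Hom B D} (hf : f.IsPiOneSurjective)
    (hg : g.IsPiOneSurjective) : (f.comp g).IsPiOneSurjective := by
  intro x l hl
  obtain ⟨m, hm, h⟩ := hg (f.onVert x) l hl
  obtain ⟨n, hn, h'⟩ := hf x m hm
  refine ⟨n, hn, ?_⟩
  have := g.homotopic_map h'
  rw [List.map_map] at this
  exact this.trans h

/-- The identity map. -/
def id (A : TwoComplex.{u}) : Hom A A where
  onVert := _root_.id
  onDart := _root_.id
  onSide := _root_.id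
  map_src _ := rfl
  map_inv _ := rfl
  map_edge _ := rfl
  map_next _ := rfl
  map_rev _ := rfl
  side_injOn _ _ _ h := h

end Hom

end TwoComplex

/-! ### Semiconjugate permutations, invariant subsets, and finiteness modulo a group -/

theorem Equiv.Perm.zpow_apply_of_semiconj {α β : Type*} {a : Equiv.Perm α} {b : Equiv.Perm β}
    {φ : α → β} (h : ∀ x, φ (a x) = b (φ x)) (i : ℤ) (x : α) : φ ((a ^ i) x) = (b ^ i) (φ x) := by
  have hs : ∀ x, φ (a⁻¹ x) = b⁻¹ (φ x) := fun x => by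
    rw [Equiv.Perm.eq_inv_iff_eq, ← h, ← Equiv.Perm.mul_apply, mul_inv_cancel,
      Equiv.Perm.one_apply]
  induction i using Int.induction_on generalizing x with
  | zero => rfl
  | succ n ih => rw [zpow_add_one, zpow_add_one, Equiv.Perm.mul_apply, ih, h]; rfl
  | pred n ih => rw [zpow_sub_one, zpow_sub_one, Equiv.Perm.mul_apply, ih, hs]; rfl

theorem Equiv.Perm.SameCycle.map_of_semiconj {α β : Type*} {a : Equiv.Perm α} {b : Equiv.Perm β}
    {φ : α → β} (h : ∀ x, φ (a x) = b (φ x)) {x y : α} (hxy : a.SameCycle x y) :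
    b.SameCycle (φ x) (φ y) := by
  obtain ⟨i, rfl⟩ := hxy
  exact ⟨i, (zpow_apply_of_semiconj h i x).symm⟩

/-- The action on an invariant subset. -/
abbrev MulAction.onSubset {G α : Type*} [Group G] [MulAction G α] (S : Set α)
    (h : ∀ (g : G), ∀ a ∈ S, g • a ∈ S) : MulAction G S where
  smul g a := ⟨g • a.1, h g a.1 a.2⟩
  one_smul a := Subtype.ext (one_smul G a.1)
  mul_smul g g' a := Subtype.ext (mul_smul g g' a.1)

/-- All elements of `β` outside the range of `φ` lie in finitely many `H`-orbits. -/
def CofiniteRange (H : Type*) {α β : Type*} [SMul H β] (φ : α → β) : Prop :=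
  ∃ F : Set β, F.Finite ∧ ∀ b, b ∈ Set.range φ ∨ ∃ h : H, ∃ e ∈ F, h • e = b

theorem CofiniteRange.of_surjective {H α β : Type*} [SMul H β] {φ : α → β}
    (h : Function.Surjective φ) : CofiniteRange H φ := ⟨∅, Set.finite_empty, fun b => .inl (h b)⟩

theorem CofiniteRange.comp {H α β γ : Type*} [SMul H β] [SMul H γ] {φ : α → β} {ψ : β → γ}
    (hφ : CofiniteRange H φ) (hψ : CofiniteRange H ψ) (he : ∀ (h : H) b, ψ (h • b) = h • ψ b) :
    CofiniteRange H (ψ ∘ φ) := by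
  obtain ⟨F, hF, h1⟩ := hφ
  obtain ⟨F', hF', h2⟩ := hψ
  refine ⟨F' ∪ ψ '' F, hF'.union (hF.image _), fun c => ?_⟩
  rcases h2 c with ⟨b, rfl⟩ | ⟨h, e, he', rfl⟩
  · rcases h1 b with ⟨a, rfl⟩ | ⟨h, e, he', rfl⟩
    · exact .inl ⟨a, rfl⟩
    · exact .inr ⟨h, ψ e, .inr ⟨e, he', rfl⟩, (he h e).symm⟩
  · exact .inr ⟨h, e, .inl he', rfl⟩

theorem CofiniteRange.finite_quotient {H α β : Type*} [Group H] [MulAction H α] [MulAction H β]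
    {φ : α → β} (hφ : CofiniteRange H φ) (he : ∀ (h : H) a, φ (h • a) = h • φ a)
    [Finite (MulAction.orbitRel.Quotient H α)] : Finite (MulAction.orbitRel.Quotient H β) := by
  obtain ⟨F, hF, h1⟩ := hφ
  have := hF.to_subtype
  let ψ : MulAction.orbitRel.Quotient H α ⊕ F → MulAction.orbitRel.Quotient H β :=
    Sum.elim (Quotient.map φ (by
      rintro a b ⟨h, rfl⟩
      exact ⟨h, (he h b).symm⟩)) (fun e => Quotient.mk _ e.1)
  refine Finite.of_surjective ψ ?_
  rintro ⟨b⟩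
  rcases h1 b with ⟨a, rfl⟩ | ⟨h, e, he', rfl⟩
  · exact ⟨.inl (Quotient.mk _ a), rfl⟩
  · exact ⟨.inr ⟨e, he'⟩, Quotient.sound ⟨h⁻¹, by simp⟩⟩

namespace TwoComplex

open OrientedGraph

/-! ## Finite extensions of immersed complexes -/

section Extension

variable (H : Type u) [Group H] {X Y Z W : TwoComplex.{u}}
  [ComplexAction H X] [ComplexAction H Y] [ComplexAction H Z] [ComplexAction H W]

theorem Hom.id_isEquivariant : (Hom.id X).IsEquivariant H :=
  ⟨fun _ _ => rfl, fun _ _ => rfl, fun _ _ => rfl⟩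

variable {H}

theorem Hom.IsEquivariant.comp {f : Hom X Y} {g : Hom Y Z} (hf : f.IsEquivariant H)
    (hg : g.IsEquivariant H) : (f.comp g).IsEquivariant H :=
  ⟨fun h v => (congrArg _ (hf.1 h v)).trans (hg.1 _ _),
    fun h v => (congrArg _ (hf.2.1 h v)).trans (hg.2.1 _ _),
    fun h v => (congrArg _ (hf.2.2 h v)).trans (hg.2.2 _ _)⟩

theorem smul_tgt (h : H) (d : X.Dart) : X.tgt (h • d) = h • X.tgt d := by
  rw [tgt, ComplexAction.smul_inv, ComplexAction.smul_src]; rfl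

theorem isPath_smul (h : H) {v w : X.Vert} {l : List X.Dart} (hl : X.IsPath v l w) :
    X.IsPath (h • v) (l.map (h • ·)) (h • w) := by
  induction l generalizing v with
  | nil => exact congrArg _ hl
  | cons d l ih =>
    obtain ⟨rfl, hl⟩ := hl
    exact ⟨ComplexAction.smul_src h d, by rw [smul_tgt]; exact ih hl⟩

theorem minimalPeriod_smul (h : H) (s : X.Side) :
    Function.minimalPeriod X.next (h • s) = Function.minimalPeriod X.next s := by
  have key : ∀ (h : H) (s : X.Side),
      Function.minimalPeriod X.next (h • s) ∣ Function.minimalPeriod X.next s := by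
    intro h s
    apply Function.IsPeriodicPt.minimalPeriod_dvd
    have hn : ∀ n, X.next^[n] (h • s) = h • X.next^[n] s := by
      intro n
      induction n with
      | zero => rfl
      | succ n ih => rw [Function.iterate_succ_apply', Function.iterate_succ_apply', ih,
          ComplexAction.smul_next]
    rw [Function.IsPeriodicPt, Function.IsFixedPt, hn, Function.iterate_minimalPeriod]
  refine Nat.dvd_antisymm (key h s) ?_
  have := key h⁻¹ (h • s)
  rwa [inv_smul_smul] at this

theorem next_zpow_smul (h : H) (i : ℤ) (s : X.Side) :
    (X.next ^ i) (h • s) = h • (X.next ^ i) s :=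
  (Equiv.Perm.zpow_apply_of_semiconj (φ := fun s => h • s)
    (fun s => (ComplexAction.smul_next h s).symm) i s).symm

theorem next_pow_smul (h : H) (n : ℕ) (s : X.Side) :
    (X.next ^ n) (h • s) = h • (X.next ^ n) s := next_zpow_smul h n s

theorem boundary_smul (h : H) (s : X.Side) :
    X.boundary (h • s) = (X.boundary s).map (h • ·) := by
  simp [boundary, minimalPeriod_smul, next_pow_smul, ComplexAction.smul_edge]

theorem SameCell.smul (h : H) {s t : X.Side} (hst : X.SameCell s t) :
    X.SameCell (h • s) (h • t) := by
  refine SameCell.induction (p := fun t => X.SameCell (h • s) (h • t)) hst (.refl _) ?_ ?_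
  · intro s hs
    rw [← ComplexAction.smul_next]
    exact hs.next
  · intro s hs
    rw [← ComplexAction.smul_rev]
    exact hs.rev

variable (H) in
/-- `Y → Z → X` is an equivariant factorization of `f` through an immersion `k`, such that `Y → Z`
is surjective on fundamental groups, and onto up to finitely many orbits of cells. -/
structure IsFiniteExtension (f : Hom Y X) (g : Hom Y Z) (k : Hom Z X) : Prop where
  left_equivariant : g.IsEquivariant H
  right_equivariant : k.IsEquivariant H
  fac : g.comp k = f
  piOneSurjective : g.IsPiOneSurjective
  immersion : k.IsImmersion
  cofinite_vert : CofiniteRange H g.onVert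
  cofinite_dart : CofiniteRange H g.onDart
  cofinite_side : CofiniteRange H g.onSide

theorem Hom.isPiOneSurjective_id : (Hom.id X).IsPiOneSurjective := fun x l hl =>
  ⟨l, hl, by
    have : l.map (Hom.id X).onDart = l := List.map_id l
    rw [this]
    exact .refl hl⟩

theorem IsFiniteExtension.refl {f : Hom Y X} (hf : f.IsEquivariant H) (hi : f.IsImmersion) :
    IsFiniteExtension H f (Hom.id Y) f where
  left_equivariant := Hom.id_isEquivariant H
  right_equivariant := hf
  fac := rfl
  piOneSurjective := Hom.isPiOneSurjective_id
  immersion := hi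
  cofinite_vert := .of_surjective Function.surjective_id
  cofinite_dart := .of_surjective Function.surjective_id
  cofinite_side := .of_surjective Function.surjective_id

theorem IsFiniteExtension.trans {f : Hom Y X} {g : Hom Y Z} {k : Hom Z X} {g' : Hom Z W}
    {k' : Hom W X} (h : IsFiniteExtension H f g k) (h' : IsFiniteExtension H k g' k') :
    IsFiniteExtension H f (g.comp g') k' where
  left_equivariant := h.left_equivariant.comp h'.left_equivariant
  right_equivariant := h'.right_equivariant
  fac := by rw [← h.fac, ← h'.fac]; rfl
  piOneSurjective := h.piOneSurjective.comp h'.piOneSurjective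
  immersion := h'.immersion
  cofinite_vert := h.cofinite_vert.comp h'.cofinite_vert h'.left_equivariant.1
  cofinite_dart := h.cofinite_dart.comp h'.cofinite_dart h'.left_equivariant.2.1
  cofinite_side := h.cofinite_side.comp h'.cofinite_side h'.left_equivariant.2.2

theorem IsFiniteExtension.fac_vert {f : Hom Y X} {g : Hom Y Z} {k : Hom Z X}
    (h : IsFiniteExtension H f g k) (v : Y.Vert) : k.onVert (g.onVert v) = f.onVert v :=
  congrArg (fun f => Hom.onVert f v) h.fac

theorem IsFiniteExtension.fac_side {f : Hom Y X} {g : Hom Y Z} {k : Hom Z X}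
    (h : IsFiniteExtension H f g k) (s : Y.Side) : k.onSide (g.onSide s) = f.onSide s :=
  congrArg (fun f => Hom.onSide f s) h.fac

theorem IsFiniteExtension.fac_path {f : Hom Y X} {g : Hom Y Z} {k : Hom Z X}
    (h : IsFiniteExtension H f g k) (l : List Y.Dart) :
    (l.map g.onDart).map k.onDart = l.map f.onDart := by
  rw [List.map_map, ← h.fac]
  rfl

/-- The first map of an extension is surjective on fundamental groups as soon as each edge path in
the extension is, up to a choice of connecting paths, homotopic to the image of an edge path. -/
theorem Hom.isPiOneSurjective_of_connecting (g : Hom Y Z) (r : Z.Vert → Y.Vert)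
    (t : Z.Vert → List Z.Dart) (ht : ∀ u, Z.IsPath (g.onVert (r u)) (t u) u)
    (hd : ∀ e : Z.Dart, ∃ q, Y.IsPath (r (Z.src e)) q (r (Z.tgt e)) ∧
      Z.Homotopic (g.onVert (r (Z.src e))) (Z.tgt e)
        (t (Z.src e) ++ [e]) (q.map g.onDart ++ t (Z.tgt e)))
    (hv : ∀ y, ∃ m, Y.IsPath y m (r (g.onVert y)) ∧
      Z.IsNullHomotopic (g.onVert y) (m.map g.onDart ++ t (g.onVert y))) :
    g.IsPiOneSurjective := by
  have key : ∀ (l : List Z.Dart) (u w : Z.Vert), Z.IsPath u l w →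
      ∃ q, Y.IsPath (r u) q (r w) ∧
        Z.Homotopic (g.onVert (r u)) w (t u ++ l) (q.map g.onDart ++ t w) := by
    intro l
    induction l with
    | nil =>
      rintro u _ rfl
      exact ⟨[], rfl, by simpa using .refl (ht u)⟩
    | cons e l ih =>
      rintro _ w ⟨rfl, hl⟩
      obtain ⟨q, hq, hq'⟩ := ih _ _ hl
      obtain ⟨p, hp, hp'⟩ := hd e
      refine ⟨p ++ q, hp.append hq, ?_⟩
      have h1 := hp'.append (.refl hl)
      have h2 := (Homotopic.refl (g.isPath_map hp)).append hq'
      simp only [List.append_assoc, List.map_append, List.singleton_append] at h1 h2 ⊢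
      exact h1.trans h2
  intro y l hl
  obtain ⟨q, hq, hq'⟩ := key l _ _ hl
  obtain ⟨m, hm, hm'⟩ := hv y
  refine ⟨m ++ q ++ Y.invPath m, (hm.append hq).append hm.inv, ?_⟩
  have hmg := g.isPath_map hm
  have hT := ht (g.onVert y)
  -- The chosen point `r (g.onVert y)` need not be `y`; conjugating by `m` corrects the base point,
  -- since the image of `m` is inverse to the connecting path.
  have hmi : Z.Homotopic (g.onVert (r (g.onVert y))) (g.onVert y)
      (Z.invPath (m.map g.onDart)) (t (g.onVert y)) := by
    refine .cancel_left hmg hmg.inv hT ?_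
    exact (append_invPath hmg).trans hm'.symm
  have h1 : Z.Homotopic (g.onVert y) (g.onVert y)
      (m.map g.onDart ++ (q.map g.onDart ++ Z.invPath (m.map g.onDart)))
      (m.map g.onDart ++ (t (g.onVert y) ++ l)) :=
    (Homotopic.refl hmg).append
      (((Homotopic.refl (g.isPath_map hq)).append hmi).trans hq'.symm)
  have h2 := hm'.append (.refl hl)
  simp only [List.map_append, ← Hom.invPath_map, List.append_assoc, List.nil_append] at h1 h2 ⊢
  exact h1.trans h2

end Extension

/-! ## Subcomplexes -/

/-- A subcomplex. -/
structure Sub (C : TwoComplex.{u}) where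
  verts : Set C.Vert
  darts : Set C.Dart
  sides : Set C.Side
  src_mem : ∀ d ∈ darts, C.src d ∈ verts
  inv_mem : ∀ d ∈ darts, C.inv d ∈ darts
  edge_mem : ∀ s ∈ sides, C.edge s ∈ darts
  next_mem : ∀ s ∈ sides, C.next s ∈ sides
  rev_mem : ∀ s ∈ sides, C.rev s ∈ sides

namespace Sub

variable {C : TwoComplex.{u}} (K : Sub C)

theorem next_symm_mem (s : C.Side) (hs : s ∈ K.sides) : C.next.symm s ∈ K.sides := by
  have := K.rev_mem _ (K.next_mem _ (K.rev_mem _ hs))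
  rwa [← C.next_symm_rev, C.rev_rev] at this

/-- The permutation of the sides of a subcomplex. -/
def nextPerm : Equiv.Perm K.sides where
  toFun s := ⟨C.next s.1, K.next_mem _ s.2⟩
  invFun s := ⟨C.next.symm s.1, K.next_symm_mem _ s.2⟩
  left_inv _ := Subtype.ext (Equiv.symm_apply_apply _ _)
  right_inv _ := Subtype.ext (Equiv.apply_symm_apply _ _)

theorem sameCycle_coe {s t : K.sides} (h : K.nextPerm.SameCycle s t) :
    C.next.SameCycle s.1 t.1 :=
  h.map_of_semiconj (φ := Subtype.val) fun _ => rfl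

/-- A subcomplex as a complex. -/
def toComplex : TwoComplex.{u} where
  Vert := K.verts
  Dart := K.darts
  src d := ⟨C.src d.1, K.src_mem _ d.2⟩
  inv d := ⟨C.inv d.1, K.inv_mem _ d.2⟩
  inv_inv d := Subtype.ext (C.inv_inv d.1)
  inv_ne d h := C.inv_ne d.1 (congrArg Subtype.val h)
  Side := K.sides
  edge s := ⟨C.edge s.1, K.edge_mem _ s.2⟩
  next := K.nextPerm
  rev s := ⟨C.rev s.1, K.rev_mem _ s.2⟩
  rev_rev s := Subtype.ext (C.rev_rev s.1)
  edge_rev s := Subtype.ext (C.edge_rev s.1)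
  src_edge_next s := Subtype.ext (C.src_edge_next s.1)
  next_rev_next s := Subtype.ext (C.next_rev_next s.1)
  next_periodic s := by
    obtain ⟨n, hn, h⟩ := C.next_periodic s.1
    refine ⟨n, hn, Subtype.ext ?_⟩
    have h1 : Function.Semiconj (Subtype.val : K.sides → C.Side) K.nextPerm C.next := fun _ => rfl
    exact (h1.iterate_right n s).trans h
  not_sameCycle_rev s h := C.not_sameCycle_rev s.1 (K.sameCycle_coe h)

/-- The inclusion of a subcomplex. -/
def incl : Hom K.toComplex C where
  onVert := Subtype.val
  onDart := Subtype.val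
  onSide := Subtype.val
  map_src _ := rfl
  map_inv _ := rfl
  map_edge _ := rfl
  map_next _ := rfl
  map_rev _ := rfl
  side_injOn _ _ _ h := Subtype.ext h

/-- A map into a subcomplex. -/
def lift {B : TwoComplex.{u}} (f : Hom B C) (hv : ∀ v, f.onVert v ∈ K.verts)
    (hd : ∀ d, f.onDart d ∈ K.darts) (hs : ∀ s, f.onSide s ∈ K.sides) : Hom B K.toComplex where
  onVert v := ⟨f.onVert v, hv v⟩
  onDart v := ⟨f.onDart v, hd v⟩
  onSide v := ⟨f.onSide v, hs v⟩
  map_src d := Subtype.ext (f.map_src d)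
  map_inv d := Subtype.ext (f.map_inv d)
  map_edge d := Subtype.ext (f.map_edge d)
  map_next d := Subtype.ext (f.map_next d)
  map_rev d := Subtype.ext (f.map_rev d)
  side_injOn s t h e := f.side_injOn s t h (congrArg Subtype.val e)

theorem incl_comp_isImmersion {D : TwoComplex.{u}} {k : Hom C D} (hk : k.IsImmersion) :
    (K.incl.comp k).IsImmersion :=
  Hom.isImmersion_iff.2 ⟨fun _ _ h h' => Subtype.ext (hk.dart_inj (congrArg Subtype.val h) h'),
    fun _ _ h h' => Subtype.ext (hk.side_inj (congrArg Subtype.val h) h')⟩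

/-- A path with edges in the subcomplex is a path in the subcomplex. -/
theorem exists_path {v w : C.Vert} {l : List C.Dart} (h : C.IsPath v l w) (hv : v ∈ K.verts)
    (hl : ∀ d ∈ l, d ∈ K.darts) : ∃ (hw : w ∈ K.verts) (m : List K.toComplex.Dart),
      K.toComplex.IsPath ⟨v, hv⟩ m ⟨w, hw⟩ ∧ m.map K.incl.onDart = l := by
  induction l generalizing v with
  | nil =>
    obtain rfl : v = w := h
    exact ⟨hv, [], rfl, rfl⟩
  | cons d l ih =>
    obtain ⟨rfl, h⟩ := h
    have hd := hl d List.mem_cons_self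
    obtain ⟨hw, m, hm, rfl⟩ := ih h (K.src_mem _ (K.inv_mem _ hd))
      fun e he => hl e (List.mem_cons_of_mem _ he)
    exact ⟨hw, ⟨d, hd⟩ :: m, ⟨rfl, hm⟩, rfl⟩

section Action

variable {H : Type u} [Group H] [ComplexAction H C]

/-- The action on an invariant subcomplex. -/
abbrev action (hv : ∀ h : H, ∀ v ∈ K.verts, h • v ∈ K.verts)
    (hd : ∀ h : H, ∀ v ∈ K.darts, h • v ∈ K.darts)
    (hs : ∀ h : H, ∀ v ∈ K.sides, h • v ∈ K.sides) : ComplexAction H K.toComplex where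
  actVert := MulAction.onSubset K.verts hv
  actDart := MulAction.onSubset K.darts hd
  actSide := MulAction.onSubset K.sides hs
  smul_src g d := Subtype.ext (ComplexAction.smul_src g d.1)
  smul_inv g d := Subtype.ext (ComplexAction.smul_inv g d.1)
  smul_edge g d := Subtype.ext (ComplexAction.smul_edge g d.1)
  smul_next g d := Subtype.ext (ComplexAction.smul_next g d.1)
  smul_rev g d := Subtype.ext (ComplexAction.smul_rev g d.1)
  smul_dart_ne_inv g d h := ComplexAction.smul_dart_ne_inv g d.1 (congrArg Subtype.val h)
  smul_side_eq g s h := Subtype.ext (ComplexAction.smul_side_eq g s.1 (K.incl.sameCell h))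

end Action

end Sub

end TwoComplex

namespace TwoComplex

open OrientedGraph

/-! ## Attaching edges -/

section AttachEdges

variable {X Y : TwoComplex.{u}}

/-- The complex obtained from `Y` by attaching, for each element `(a, d)` of `O`, an edge with
initial vertex `a` and a new terminal vertex. -/
def attachEdges (O : Set (Y.Vert × X.Dart)) : TwoComplex.{u} where
  Vert := Y.Vert ⊕ O
  Dart := Y.Dart ⊕ (O ⊕ O)
  src := Sum.elim (fun d => .inl (Y.src d)) (Sum.elim (fun o => .inl o.1.1) fun o => .inr o)
  inv := Sum.elim (fun d => .inl (Y.inv d)) (Sum.elim (fun o => .inr (.inr o)) fun o => .inr (.inl o))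
  inv_inv := by rintro (d | o | o) <;> simp [Y.inv_inv]
  inv_ne := by rintro (d | o | o) <;> simp [Y.inv_ne]
  Side := Y.Side
  edge s := .inl (Y.edge s)
  next := Y.next
  rev := Y.rev
  rev_rev := Y.rev_rev
  edge_rev s := congrArg Sum.inl (Y.edge_rev s)
  src_edge_next s := congrArg Sum.inl (Y.src_edge_next s)
  next_rev_next := Y.next_rev_next
  next_periodic := Y.next_periodic
  not_sameCycle_rev := Y.not_sameCycle_rev

/-- The inclusion of `Y` in the complex with additional edges. -/
def attachEdgesIncl (O : Set (Y.Vert × X.Dart)) : Hom Y (attachEdges O) where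
  onVert := Sum.inl
  onDart := Sum.inl
  onSide := _root_.id
  map_src _ := rfl
  map_inv _ := rfl
  map_edge _ := rfl
  map_next _ := rfl
  map_rev _ := rfl
  side_injOn _ _ _ h := h

/-- The extension of a map to the additional edges. -/
def attachEdgesDesc (f : Hom Y X) (O : Set (Y.Vert × X.Dart))
    (hO : ∀ o ∈ O, X.src o.2 = f.onVert o.1) : Hom (attachEdges O) X where
  onVert := Sum.elim f.onVert fun o => X.tgt o.1.2
  onDart := Sum.elim f.onDart (Sum.elim (fun o => o.1.2) fun o => X.inv o.1.2)
  onSide := f.onSide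
  map_src := by
    rintro (d | o | o)
    · exact f.map_src d
    · exact hO o.1 o.2
    · rfl
  map_inv := by
    rintro (d | o | o)
    · exact f.map_inv d
    · rfl
    · exact X.inv_inv _
  map_edge := f.map_edge
  map_next := f.map_next
  map_rev := f.map_rev
  side_injOn := f.side_injOn

/-- No element of `O` is already realized by an edge of `Y`, distinct elements at the same vertex
have distinct images, and each new vertex is the end of a single edge. -/
theorem attachEdgesDesc_isImmersion {f : Hom Y X} (hf : f.IsImmersion)
    {O : Set (Y.Vert × X.Dart)} (hO : ∀ o ∈ O, X.src o.2 = f.onVert o.1)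
    (hO' : ∀ d, (Y.src d, f.onDart d) ∉ O) : (attachEdgesDesc f O hO).IsImmersion := by
  refine Hom.isImmersion_iff.2 ⟨?_, fun s t h h' => hf.side_inj (Sum.inl_injective h) h'⟩
  rintro (d | ⟨⟨a, d⟩, ho⟩ | o) (e | ⟨⟨b, e⟩, ho'⟩ | o') h1 h2
  · exact congrArg _ (hf.dart_inj (Sum.inl_injective h1) h2)
  · obtain rfl : Y.src d = b := Sum.inl_injective h1
    obtain rfl : f.onDart d = e := h2
    exact (hO' d ho').elim
  · cases h1
  · obtain rfl : a = Y.src e := Sum.inl_injective h1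
    obtain rfl : d = f.onDart e := h2
    exact (hO' e ho).elim
  · obtain rfl : a = b := Sum.inl_injective h1
    obtain rfl : d = e := h2
    rfl
  · cases h1
  · cases h1
  · cases h1
  · obtain rfl : o = o' := Sum.inr_injective h1
    rfl

/-- The new edges are hairs: each new vertex is retracted to its attaching vertex, with the hair as
connecting path. -/
theorem attachEdgesIncl_isPiOneSurjective (O : Set (Y.Vert × X.Dart)) :
    (attachEdgesIncl O).IsPiOneSurjective := by
  refine Hom.isPiOneSurjective_of_connecting _ (Sum.elim _root_.id fun o => o.1.1)
    (Sum.elim (fun _ => []) fun o => [.inr (.inl o)]) ?_ ?_ ?_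
  · rintro (y | o)
    · rfl
    · exact ⟨rfl, rfl⟩
  · rintro (d | o | o)
    · exact ⟨[d], ⟨rfl, rfl⟩, .refl ⟨rfl, rfl⟩⟩
    · exact ⟨[], rfl, .refl ⟨rfl, rfl⟩⟩
    · exact ⟨[], rfl, homotopic_backtrack (C := attachEdges O) (.inr (.inl o))⟩
  · exact fun y => ⟨[], rfl, .refl rfl⟩

variable {H : Type u} [Group H] [ComplexAction H X] [ComplexAction H Y]

/-- The action on the complex with an orbit of additional edges. -/
abbrev attachEdgesAction (o : Y.Vert × X.Dart) :
    ComplexAction H (attachEdges (MulAction.orbit H o)) where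
  actVert := inferInstanceAs (MulAction H (Y.Vert ⊕ MulAction.orbit H o))
  actDart := inferInstanceAs
    (MulAction H (Y.Dart ⊕ (MulAction.orbit H o ⊕ MulAction.orbit H o)))
  actSide := inferInstanceAs (MulAction H Y.Side)
  smul_src g := by
    rintro (d | o | o)
    · exact congrArg Sum.inl (ComplexAction.smul_src g d)
    · rfl
    · rfl
  smul_inv g := by
    rintro (d | o | o)
    · exact congrArg Sum.inl (ComplexAction.smul_inv g d)
    · rfl
    · rfl
  smul_edge (g : H) (s : Y.Side) := congrArg Sum.inl (ComplexAction.smul_edge g s)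
  smul_next (g : H) (s : Y.Side) := (ComplexAction.smul_next g s : Y.next (g • s) = _)
  smul_rev (g : H) (s : Y.Side) := (ComplexAction.smul_rev g s : Y.rev (g • s) = _)
  smul_dart_ne_inv g := by
    rintro (d | o | o) h
    · exact ComplexAction.smul_dart_ne_inv g d (Sum.inl_injective h)
    · cases Sum.inr_injective h
    · cases Sum.inr_injective h
  smul_side_eq (g : H) (s : Y.Side) (h : Y.SameCell s (g • s)) := ComplexAction.smul_side_eq g s h

/-- An edge can be lifted in a finite extension. -/
theorem exists_extension_dart (f : Hom Y X) (hf : f.IsEquivariant H) (hi : f.IsImmersion)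
    (a : Y.Vert) (d : X.Dart) (hd : X.src d = f.onVert a) :
    ∃ (Z : TwoComplex.{u}) (_ : ComplexAction H Z) (g : Hom Y Z) (k : Hom Z X),
      IsFiniteExtension H f g k ∧ ∃ e, Z.src e = g.onVert a ∧ k.onDart e = d := by
  by_cases h : ∃ e, Y.src e = a ∧ f.onDart e = d
  · exact ⟨Y, inferInstance, Hom.id Y, f, .refl hf hi, h⟩
  have hO : ∀ p ∈ MulAction.orbit H (a, d), X.src p.2 = f.onVert p.1 := by
    rintro _ ⟨h, rfl⟩
    change X.src (h • d) = f.onVert (h • a)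
    rw [ComplexAction.smul_src, hf.1, hd]
  -- A lift of a translate of `d` at the same translate of `a` could be translated back to a lift of
  -- `d` at `a`.
  have hO' : ∀ d', (Y.src d', f.onDart d') ∉ MulAction.orbit H (a, d) := by
    rintro d' ⟨g, hg⟩
    have h1 : g • a = Y.src d' := congrArg Prod.fst hg
    have h2 : g • d = f.onDart d' := congrArg Prod.snd hg
    refine h ⟨g⁻¹ • d', ?_, ?_⟩
    · rw [ComplexAction.smul_src, ← h1, inv_smul_smul]
    · rw [hf.2.1, ← h2, inv_smul_smul]
  let _ : ComplexAction H (attachEdges (MulAction.orbit H (a, d))) :=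
    attachEdgesAction (a, d)
  have hmem := MulAction.mem_orbit_self (M := H) (a, d)
  refine ⟨attachEdges (MulAction.orbit H (a, d)), inferInstance, attachEdgesIncl _,
    attachEdgesDesc f _ hO, ⟨⟨fun _ _ => rfl, fun _ _ => rfl, fun _ _ => rfl⟩, ⟨?_, ?_, hf.2.2⟩,
      rfl, attachEdgesIncl_isPiOneSurjective _, attachEdgesDesc_isImmersion hi hO hO', ?_, ?_,
      .of_surjective Function.surjective_id⟩, .inr (.inl ⟨(a, d), hmem⟩), rfl, rfl⟩
  · rintro g (y | o)
    · exact hf.1 g y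
    · exact smul_tgt g o.1.2
  · rintro g (y | o | o)
    · exact hf.2.1 g y
    · rfl
    · exact ComplexAction.smul_inv g o.1.2
  · refine ⟨{.inr ⟨(a, d), hmem⟩}, Set.finite_singleton _, ?_⟩
    rintro (y | ⟨_, g, rfl⟩)
    · exact .inl ⟨y, rfl⟩
    · exact .inr ⟨g, _, rfl, rfl⟩
  · refine ⟨{.inr (.inl ⟨(a, d), hmem⟩), .inr (.inr ⟨(a, d), hmem⟩)}, Set.toFinite _, ?_⟩
    rintro (y | ⟨_, g, rfl⟩ | ⟨_, g, rfl⟩)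
    · exact .inl ⟨y, rfl⟩
    · exact .inr ⟨g, _, .inl rfl, rfl⟩
    · exact .inr ⟨g, _, .inr rfl, rfl⟩

/-- A path can be lifted in a finite extension. -/
theorem exists_extension_path (f : Hom Y X) (hf : f.IsEquivariant H) (hi : f.IsImmersion)
    (a : Y.Vert) (l : List X.Dart) (b : X.Vert) (hl : X.IsPath (f.onVert a) l b) :
    ∃ (Z : TwoComplex.{u}) (_ : ComplexAction H Z) (g : Hom Y Z) (k : Hom Z X),
      IsFiniteExtension H f g k ∧ ∃ m c, Z.IsPath (g.onVert a) m c ∧ m.map k.onDart = l := by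
  induction l using List.reverseRecOn generalizing b with
  | nil => exact ⟨Y, inferInstance, Hom.id Y, f, .refl hf hi, [], a, rfl, rfl⟩
  | append_singleton l d ih =>
    obtain ⟨x, hl, rfl, -⟩ := isPath_append.1 hl
    obtain ⟨Z, _, g, k, hk, m, c, hm, rfl⟩ := ih _ hl
    have hc : X.src d = k.onVert c := by
      have := k.isPath_map hm
      rw [hk.fac_vert] at this
      exact hl.target_unique this
    obtain ⟨W, _, g', k', hk', e, he, rfl⟩ :=
      exists_extension_dart k hk.right_equivariant hk.immersion c d hc
    refine ⟨W, inferInstance, g.comp g', k', hk.trans hk', m.map g'.onDart ++ [e], W.tgt e,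
      (g'.isPath_map hm).append ⟨he, rfl⟩, ?_⟩
    rw [List.map_append, hk'.fac_path]
    rfl

end AttachEdges

end TwoComplex

namespace TwoComplex

open OrientedGraph

/-! ## Two-cells along lifts of boundary paths -/

theorem next_pow_emod {C : TwoComplex.{u}} (s : C.Side) (i : ℤ) :
    (C.next ^ (i % (Function.minimalPeriod C.next s : ℤ)).toNat) s = (C.next ^ i) s := by
  have h : ((i % (Function.minimalPeriod C.next s : ℤ)).toNat : ℤ) =
      i % (Function.minimalPeriod C.next s : ℤ) :=
    Int.toNat_of_nonneg (Int.emod_nonneg _ (by exact_mod_cast (minimalPeriod_pos s).ne'))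
  rw [← zpow_natCast, h]
  exact MulAction.zpow_smul_mod_minimalPeriod C.next s i

theorem emod_eq_of_next_zpow_eq {C : TwoComplex.{u}} {s : C.Side} {i j : ℤ}
    (h : (C.next ^ i) s = (C.next ^ j) s) :
    i % (Function.minimalPeriod C.next s : ℤ) = j % (Function.minimalPeriod C.next s : ℤ) := by
  have h1 : (C.next ^ (i - j)) • s = s := by
    rw [Equiv.Perm.smul_def, sub_eq_neg_add, zpow_add, Equiv.Perm.mul_apply, h,
      ← Equiv.Perm.mul_apply, ← zpow_add, neg_add_cancel, zpow_zero, Equiv.Perm.one_apply]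
  have h2 := MulAction.zpow_smul_eq_iff_minimalPeriod_dvd.1 h1
  exact Int.emod_eq_emod_iff_emod_sub_eq_zero.2 (Int.emod_eq_zero_of_dvd h2)

theorem finite_sameCell {C : TwoComplex.{u}} (s : C.Side) : {t | C.SameCell s t}.Finite := by
  have key : ∀ s : C.Side, {t | C.next.SameCycle s t}.Finite := by
    intro s
    refine ((Set.finite_lt_nat (Function.minimalPeriod C.next s)).image
      fun k => (C.next ^ k) s).subset ?_
    rintro _ ⟨i, rfl⟩
    refine ⟨_, ?_, next_pow_emod s i⟩
    have h := minimalPeriod_pos s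
    have := Int.emod_lt_of_pos i (b := (Function.minimalPeriod C.next s : ℤ))
      (by exact_mod_cast h)
    simp only [Set.mem_ofPred_eq]
    omega
  exact (key s).union (key (C.rev s))

theorem next_zpow_rev {C : TwoComplex.{u}} (s : C.Side) (i : ℤ) :
    (C.next ^ i) (C.rev s) = C.rev ((C.next ^ (-i)) s) := by
  have := Equiv.Perm.zpow_apply_of_semiconj (a := C.next⁻¹) (b := C.next) (φ := C.rev)
    (fun s => (C.next_rev s).symm) i s
  rw [← this, inv_zpow']

/-- A map of graphs. -/
structure _root_.OrientedGraph.GraphMap (Γ Δ : OrientedGraph.{u}) where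
  onVert : Γ.Vert → Δ.Vert
  onDart : Γ.Dart → Δ.Dart
  map_src : ∀ d, Δ.src (onDart d) = onVert (Γ.src d)
  map_inv : ∀ d, Δ.inv (onDart d) = onDart (Γ.inv d)

section Lifted

variable {X : TwoComplex.{u}} {Γ : OrientedGraph.{u}} (φ : GraphMap Γ X.toOrientedGraph)

/-- A side of `X` together with a closed lift to `Γ` of the boundary path that starts with it. -/
@[ext]
structure LiftedSide where
  -- Indexing by all integers turns `next` into a shift and reversal into negation of the index. The
  -- field `periodic` says that the lift closes up.
  dart : ℤ → Γ.Dart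
  side : X.Side
  map_dart : ∀ i, φ.onDart (dart i) = X.edge ((X.next ^ i) side)
  src_dart : ∀ i, Γ.src (dart (i + 1)) = Γ.tgt (dart i)
  periodic : ∀ i j, (X.next ^ i) side = (X.next ^ j) side → dart i = dart j

namespace LiftedSide

variable {φ}

/-- The next lifted side. -/
def nextPerm : Equiv.Perm (LiftedSide φ) where
  toFun σ :=
    { dart := fun i => σ.dart (i + 1)
      side := X.next σ.side
      map_dart := fun i => by rw [σ.map_dart, zpow_add_one, Equiv.Perm.mul_apply]
      src_dart := fun i => σ.src_dart (i + 1)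
      periodic := fun i j h => σ.periodic _ _ (by
        rwa [zpow_add_one, zpow_add_one, Equiv.Perm.mul_apply, Equiv.Perm.mul_apply]) }
  invFun σ :=
    { dart := fun i => σ.dart (i - 1)
      side := X.next⁻¹ σ.side
      map_dart := fun i => by rw [σ.map_dart, zpow_sub_one, Equiv.Perm.mul_apply]
      src_dart := fun i => by rw [← σ.src_dart (i - 1)]; congr 2; ring
      periodic := fun i j h => σ.periodic _ _ (by
        rwa [zpow_sub_one, zpow_sub_one, Equiv.Perm.mul_apply, Equiv.Perm.mul_apply]) }
  left_inv σ := by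
    refine LiftedSide.ext (funext fun i => ?_) (Equiv.symm_apply_apply _ _)
    exact congrArg σ.dart (by ring)
  right_inv σ := by
    refine LiftedSide.ext (funext fun i => ?_) (Equiv.apply_symm_apply _ _)
    exact congrArg σ.dart (by ring)

/-- A lifted side with the opposite orientation. -/
def rev (σ : LiftedSide φ) : LiftedSide φ where
  dart i := Γ.inv (σ.dart (-i))
  side := X.rev σ.side
  map_dart i := by rw [← φ.map_inv, σ.map_dart, next_zpow_rev, X.edge_rev]
  src_dart i := by
    rw [tgt_inv, src_inv, ← σ.src_dart]
    congr 2
    ring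
  periodic i j h := by
    rw [next_zpow_rev, next_zpow_rev] at h
    rw [σ.periodic (-i) (-j)]
    rw [← X.rev_rev ((X.next ^ (-i)) σ.side), h, X.rev_rev]

theorem zpow_next_side (σ : LiftedSide φ) (i : ℤ) :
    ((nextPerm ^ i) σ).side = (X.next ^ i) σ.side :=
  Equiv.Perm.zpow_apply_of_semiconj (a := nextPerm) (φ := LiftedSide.side) (fun _ => rfl) i σ

theorem zpow_next_dart (σ : LiftedSide φ) (i j : ℤ) :
    ((nextPerm ^ i) σ).dart j = σ.dart (j + i) := by
  induction i using Int.induction_on generalizing σ with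
  | zero => simp
  | succ n ih =>
    rw [zpow_add_one, Equiv.Perm.mul_apply, ih, ← add_assoc]
    rfl
  | pred n ih =>
    rw [zpow_sub_one, Equiv.Perm.mul_apply, ih, ← add_sub_assoc]
    rfl

/-- A side of `X` and a closed lift of its boundary path give a lifted side. -/
theorem exists_of_isPath (s : X.Side) {a : Γ.Vert} {l : List Γ.Dart} (hl : Γ.IsPath a l a)
    (hs : l.map φ.onDart = X.boundary s) :
    ∃ σ : LiftedSide φ, σ.side = s ∧ Γ.src (σ.dart 0) = a := by
  have hpos := minimalPeriod_pos s
  have hlen : l.length = Function.minimalPeriod X.next s := by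
    have := congrArg List.length hs
    simpa [boundary] using this
  have hmod : ∀ i : ℤ, (i % (Function.minimalPeriod X.next s : ℤ)).toNat < l.length := by
    intro i
    have := Int.emod_lt_of_pos i (b := (Function.minimalPeriod X.next s : ℤ))
      (by exact_mod_cast hpos)
    omega
  have hget : ∀ (i : ℕ) (hi : i < l.length), φ.onDart l[i] = X.edge ((X.next ^ i) s) := by
    intro i hi
    have h : (l.map φ.onDart)[i]? = (X.boundary s)[i]? := by rw [hs]
    rw [hlen] at hi
    simpa [boundary, hlen, hi] using h
  refine ⟨⟨fun i => l[(i % (Function.minimalPeriod X.next s : ℤ)).toNat]'(hmod i), s, ?_, ?_, ?_⟩,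
    rfl, ?_⟩
  · intro i
    rw [hget, next_pow_emod]
  · intro i
    have h1 := Int.emod_nonneg i (b := (Function.minimalPeriod X.next s : ℤ)) (by omega)
    have h2 := Int.emod_lt_of_pos i (b := (Function.minimalPeriod X.next s : ℤ)) (by omega)
    -- The list is repeated periodically; at the wrap-around the edges fit because the path `l` is
    -- closed.
    by_cases h : i % (Function.minimalPeriod X.next s : ℤ) + 1 = Function.minimalPeriod X.next s
    · have h3 : (i + 1) % (Function.minimalPeriod X.next s : ℤ) = 0 := by
        rw [← Int.emod_add_emod, h, Int.emod_self]
      simp only [h3, Int.toNat_zero]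
      rw [hl.src_getElem_zero, hl.tgt_getElem_last]
      omega
    · have h3 : ((i + 1) % (Function.minimalPeriod X.next s : ℤ)).toNat =
          (i % (Function.minimalPeriod X.next s : ℤ)).toNat + 1 := by
        rw [← Int.emod_add_emod, Int.emod_eq_of_lt (by omega) (by omega)]
        omega
      simp only [h3]
      exact hl.src_getElem _ (by omega)
  · intro i j h
    simp only [emod_eq_of_next_zpow_eq h]
  · simp only [Int.zero_emod, Int.toNat_zero]
    exact hl.src_getElem_zero (by omega)

end LiftedSide

/-- The complex with underlying graph `Γ` whose `2`-cells are all closed lifts of the boundary paths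
of the `2`-cells of `X`. -/
def liftedComplex : TwoComplex.{u} where
  toOrientedGraph := Γ
  Side := LiftedSide φ
  edge σ := σ.dart 0
  next := LiftedSide.nextPerm
  rev := LiftedSide.rev
  rev_rev σ := LiftedSide.ext (funext fun i => by simp [LiftedSide.rev, Γ.inv_inv])
    (X.rev_rev _)
  edge_rev σ := by simp [LiftedSide.rev]
  src_edge_next σ := σ.src_dart 0
  next_rev_next σ := LiftedSide.ext
    (funext fun i => congrArg (fun j => Γ.inv (σ.dart j)) (by ring)) (X.next_rev_next _)
  next_periodic σ := by
    refine ⟨_, minimalPeriod_pos σ.side, ?_⟩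
    rw [Function.IsPeriodicPt, Function.IsFixedPt, Equiv.Perm.iterate_eq_pow, ← zpow_natCast]
    have h : (X.next ^ (Function.minimalPeriod X.next σ.side : ℤ)) σ.side = σ.side := by
      rw [zpow_natCast, next_pow_minimalPeriod]
    refine LiftedSide.ext (funext fun i => ?_) ?_
    · rw [LiftedSide.zpow_next_dart]
      apply σ.periodic
      rw [zpow_add, Equiv.Perm.mul_apply, h]
    · rw [LiftedSide.zpow_next_side, h]
  not_sameCycle_rev σ h := X.not_sameCycle_rev σ.side
    (h.map_of_semiconj (φ := LiftedSide.side) fun _ => rfl)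

/-- The projection to `X`. -/
def liftedComplexProj : Hom (liftedComplex φ) X where
  onVert := φ.onVert
  onDart := φ.onDart
  onSide := LiftedSide.side
  map_src := φ.map_src
  map_inv := φ.map_inv
  map_edge σ := (σ.map_dart 0).symm
  map_next _ := rfl
  map_rev _ := rfl
  side_injOn := by
    rintro σ _ (⟨i, rfl⟩ | ⟨i, rfl⟩) h
    -- If a shift fixes the underlying side in `X`, then `periodic` shows that it fixes the whole
    -- lift.
    · have h1 : σ.side = (X.next ^ i) σ.side := h.trans (LiftedSide.zpow_next_side σ i)
      refine LiftedSide.ext (funext fun j => ?_) h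
      refine Eq.trans ?_ (LiftedSide.zpow_next_dart σ i j).symm
      apply σ.periodic
      rw [zpow_add, Equiv.Perm.mul_apply, ← h1]
    · have h1 : σ.side = (X.next ^ i) (X.rev σ.side) :=
        h.trans (LiftedSide.zpow_next_side σ.rev i)
      exact (X.not_sameCycle_rev σ.side (Equiv.Perm.SameCycle.symm ⟨i, h1.symm⟩)).elim

/-- By unique path lifting in both directions, a lifted side is determined by its side in `X` and
its initial vertex. -/
theorem liftedComplexProj_isImmersion
    (hφ : ∀ d e, Γ.src d = Γ.src e → φ.onDart d = φ.onDart e → d = e) :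
    (liftedComplexProj φ).IsImmersion := by
  refine Hom.isImmersion_iff.2 ⟨hφ, fun σ τ h1 h2 => ?_⟩
  have h2 : σ.side = τ.side := h2
  have hd : ∀ i, φ.onDart (σ.dart i) = φ.onDart (τ.dart i) := fun i => by
    rw [σ.map_dart, τ.map_dart, h2]
  refine LiftedSide.ext (funext fun i => ?_) h2
  induction i using Int.induction_on with
  | zero => exact hφ _ _ h1 (hd 0)
  | succ n ih => exact hφ _ _ (by rw [σ.src_dart, τ.src_dart, ih]) (hd _)
  | pred n ih =>
    have h3 := σ.src_dart (-n - 1)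
    have h4 := τ.src_dart (-n - 1)
    rw [sub_add_cancel] at h3 h4
    have h5 : Γ.inv (σ.dart (-n - 1)) = Γ.inv (τ.dart (-n - 1)) := by
      apply hφ
      · rw [src_inv, src_inv, ← h3, ← h4, ih]
      · rw [← φ.map_inv, ← φ.map_inv, hd]
    rw [← Γ.inv_inv (σ.dart (-n - 1)), h5, Γ.inv_inv]

/-- A map to `X` that factors through `Γ` on the `1`-skeleton. -/
def liftedComplexLift {Y : TwoComplex.{u}} (f : Hom Y X) (ψ : GraphMap Y.toOrientedGraph Γ)
    (hd : ∀ d, φ.onDart (ψ.onDart d) = f.onDart d) : Hom Y (liftedComplex φ) where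
  onVert := ψ.onVert
  onDart := ψ.onDart
  onSide s :=
    { dart := fun i => ψ.onDart (Y.edge ((Y.next ^ i) s))
      side := f.onSide s
      map_dart := fun i => by
        rw [hd, ← f.map_edge, Equiv.Perm.zpow_apply_of_semiconj fun s => (f.map_next s).symm]
      src_dart := fun i => by
        rw [ψ.map_src, add_comm, zpow_add, zpow_one, Equiv.Perm.mul_apply, Y.src_edge_next, tgt,
          ψ.map_inv, ψ.map_src]
      periodic := fun i j h => by
        have h1 : ∀ i : ℤ, (X.next ^ i) (f.onSide s) = f.onSide ((Y.next ^ i) s) := fun i =>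
          (Equiv.Perm.zpow_apply_of_semiconj (fun s => (f.map_next s).symm) i s).symm
        rw [h1, h1] at h
        -- As `f` is injective on each `2`-cell, sides of one cell that agree in `X` already agree
        -- in `Y`.
        rw [f.side_injOn _ _ (Or.inl ⟨j - i, by
          rw [← Equiv.Perm.mul_apply, ← zpow_add, sub_add_cancel]⟩) h] }
  map_src := ψ.map_src
  map_inv := ψ.map_inv
  map_edge _ := rfl
  map_next s := LiftedSide.ext (funext fun i => by
    change ψ.onDart (Y.edge ((Y.next ^ (i + 1)) s)) = _
    rw [zpow_add_one, Equiv.Perm.mul_apply]) (f.map_next s)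
  map_rev s := LiftedSide.ext (funext fun i => by
    change Γ.inv (ψ.onDart (Y.edge ((Y.next ^ (-i)) s))) = ψ.onDart (Y.edge ((Y.next ^ i) (Y.rev s)))
    rw [next_zpow_rev, Y.edge_rev, ψ.map_inv]) (f.map_rev s)
  side_injOn s t h e := f.side_injOn s t h (congrArg LiftedSide.side e)

section Action

variable {H : Type u} [Group H] [ComplexAction H X] [MulAction H Γ.Vert] [MulAction H Γ.Dart]

/-- The action on `liftedComplex φ` induced by an action on `Γ`. -/
abbrev liftedComplexAction (hsrc : ∀ (h : H) d, Γ.src (h • d) = h • Γ.src d)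
    (hinv : ∀ (h : H) d, Γ.inv (h • d) = h • Γ.inv d)
    (hφ : ∀ (h : H) d, φ.onDart (h • d) = h • φ.onDart d) :
    ComplexAction H (liftedComplex φ) :=
  let act : MulAction H (LiftedSide φ) :=
    { smul := fun h σ =>
        { dart := fun i => h • σ.dart i
          side := h • σ.side
          map_dart := fun i => by
            rw [hφ, σ.map_dart, next_zpow_smul, ComplexAction.smul_edge]
          src_dart := fun i => by rw [hsrc, σ.src_dart, tgt, tgt, hinv, hsrc]
          periodic := fun i j e => by
            rw [next_zpow_smul, next_zpow_smul] at e
            rw [σ.periodic i j (smul_left_cancel h e)] }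
      one_smul := fun σ => LiftedSide.ext (funext fun i => one_smul H _) (one_smul H _)
      mul_smul := fun g h σ => LiftedSide.ext (funext fun i => mul_smul g h _) (mul_smul g h _) }
  { actVert := inferInstanceAs (MulAction H Γ.Vert)
    actDart := inferInstanceAs (MulAction H Γ.Dart)
    actSide := act
    smul_src := hsrc
    smul_inv := hinv
    smul_edge := fun _ _ => rfl
    smul_next := fun h σ => LiftedSide.ext rfl (ComplexAction.smul_next h σ.side)
    smul_rev := fun h σ => LiftedSide.ext (funext fun i => hinv h _)
      (ComplexAction.smul_rev h σ.side)
    -- Absence of inversions is inherited from `X` along the equivariant projection.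
    smul_dart_ne_inv := fun h d e => by
      exact ComplexAction.smul_dart_ne_inv h (φ.onDart d)
        ((hφ h d).symm.trans ((congrArg φ.onDart e).trans (φ.map_inv d).symm))
    smul_side_eq := fun h σ e => ((liftedComplexProj φ).side_injOn _ _ e
      (ComplexAction.smul_side_eq h σ.side ((liftedComplexProj φ).sameCell e)).symm).symm }

end Action

end Lifted

end TwoComplex

namespace TwoComplex

open OrientedGraph

/-! ## Folding -/

section Fold

variable {X Y : TwoComplex.{u}} (f : Hom Y X) (r : Y.Vert → Y.Vert → Prop)

/-- The equivalence relation on the `0`-cells of `Y` that is generated by `r` and by folding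
edges with the same image in `X`. -/
inductive FoldRel : Y.Vert → Y.Vert → Prop
  | base (a b : Y.Vert) : r a b → FoldRel a b
  | refl (a : Y.Vert) : FoldRel a a
  | symm (a b : Y.Vert) : FoldRel a b → FoldRel b a
  | trans (a b c : Y.Vert) : FoldRel a b → FoldRel b c → FoldRel a c
  | fold (d e : Y.Dart) : f.onDart d = f.onDart e → FoldRel (Y.src d) (Y.src e) →
      FoldRel (Y.tgt d) (Y.tgt e)

variable {f r} in
theorem FoldRel.map_eq (hr : ∀ a b, r a b → f.onVert a = f.onVert b) {a b : Y.Vert}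
    (h : FoldRel f r a b) : f.onVert a = f.onVert b := by
  induction h with
  | base a b h => exact hr a b h
  | refl a => rfl
  | symm a b _ ih => exact ih.symm
  | trans a b c _ _ ih ih' => exact ih.trans ih'
  | fold d e h _ _ => rw [← f.map_tgt, ← f.map_tgt, h]

/-- The folding relation on `0`-cells as a setoid. -/
def foldVertSetoid : Setoid Y.Vert where
  r := FoldRel f r
  iseqv := ⟨.refl, .symm _ _, .trans _ _ _⟩

/-- The folding relation on oriented edges as a setoid. -/
def foldDartSetoid : Setoid Y.Dart where
  r d e := f.onDart d = f.onDart e ∧ FoldRel f r (Y.src d) (Y.src e)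
  iseqv := ⟨fun _ => ⟨rfl, .refl _⟩, fun h => ⟨h.1.symm, .symm _ _ h.2⟩,
    fun h h' => ⟨h.1.trans h'.1, .trans _ _ _ h.2 h'.2⟩⟩

/-- The graph obtained from the `1`-skeleton of `Y` by identifying `0`-cells according to `r` and
folding. -/
def foldGraph : OrientedGraph.{u} where
  Vert := Quotient (foldVertSetoid f r)
  Dart := Quotient (foldDartSetoid f r)
  src := Quotient.map Y.src fun _ _ h => h.2
  inv := Quotient.map Y.inv fun d e h =>
    ⟨by rw [← f.map_inv, ← f.map_inv, h.1], .fold d e h.1 h.2⟩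
  inv_inv := by
    rintro ⟨d⟩
    exact congrArg (Quotient.mk _) (Y.inv_inv d)
  inv_ne := by
    rintro ⟨d⟩ h
    -- Folding never identifies an edge with its reverse, since their images in `X` differ.
    have h1 : f.onDart (Y.inv d) = f.onDart d := (Quotient.exact h).1
    rw [← f.map_inv] at h1
    exact X.inv_ne _ h1

/-- The quotient map. -/
def foldMk : GraphMap Y.toOrientedGraph (foldGraph f r) where
  onVert := Quotient.mk _
  onDart := Quotient.mk _
  map_src _ := rfl
  map_inv _ := rfl

/-- The map from the folded graph to `X`. -/
def foldDesc (hr : ∀ a b, r a b → f.onVert a = f.onVert b) :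
    GraphMap (foldGraph f r) X.toOrientedGraph where
  onVert := Quotient.lift f.onVert fun _ _ h => FoldRel.map_eq hr h
  onDart := Quotient.lift f.onDart fun _ _ h => h.1
  map_src := by
    rintro ⟨d⟩
    exact f.map_src d
  map_inv := by
    rintro ⟨d⟩
    exact f.map_inv d

/-- Edges are identified exactly when they have the same image and equivalent sources, and `FoldRel`
is closed under the resulting identification of targets; so no further fold is possible. -/
theorem foldDesc_injective (hr : ∀ a b, r a b → f.onVert a = f.onVert b)
    (d e : (foldGraph f r).Dart) (h : (foldGraph f r).src d = (foldGraph f r).src e)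
    (h' : (foldDesc f r hr).onDart d = (foldDesc f r hr).onDart e) : d = e := by
  induction d using Quotient.inductionOn with | _ d =>
  induction e using Quotient.inductionOn with | _ e =>
  exact Quotient.sound ⟨h', Quotient.exact h⟩

variable {f r}

/-- Vertices that are identified by folding are joined by null-homotopic paths, if this is true for
the relation `r`. -/
theorem FoldRel.exists_path {Z : TwoComplex.{u}} (g : Hom Y Z)
    (hg : ∀ d e, f.onDart d = f.onDart e → FoldRel f r (Y.src d) (Y.src e) →
      g.onDart d = g.onDart e)
    (hr : ∀ a b, r a b → ∃ p, Y.IsPath a p b ∧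
      Z.Homotopic (g.onVert a) (g.onVert b) (p.map g.onDart) [])
    {a b : Y.Vert} (h : FoldRel f r a b) :
    ∃ p, Y.IsPath a p b ∧ Z.Homotopic (g.onVert a) (g.onVert b) (p.map g.onDart) [] := by
  induction h with
  | base a b h => exact hr a b h
  | refl a => exact ⟨[], rfl, .refl rfl⟩
  | symm a b _ ih =>
    obtain ⟨p, hp, h⟩ := ih
    refine ⟨Y.invPath p, hp.inv, ?_⟩
    rw [← Hom.invPath_map]
    exact h.inv
  | trans a b c _ _ ih ih' =>
    obtain ⟨p, hp, h⟩ := ih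
    obtain ⟨q, hq, h'⟩ := ih'
    refine ⟨p ++ q, hp.append hq, ?_⟩
    rw [List.map_append]
    exact h.append h'
  | fold d e hde hs ih =>
    obtain ⟨p, hp, h⟩ := ih
    have hd := hg d e hde hs
    -- Go back along `d`, across by `p`, and out along `e`. The image of `p` contracts and `d`, `e`
    -- have the same image, so a backtrack remains.
    refine ⟨Y.inv d :: (p ++ [e]), ⟨rfl, ?_⟩, ?_⟩
    · rw [tgt_inv]
      exact hp.append ⟨rfl, rfl⟩
    · have h1 := h.append_both (a := [g.onDart (Y.inv d)]) (b := [g.onDart e])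
        (x := g.onVert (Y.tgt d)) (y := g.onVert (Y.tgt e))
        ⟨by rw [g.map_src]; rfl, by rw [g.map_tgt, tgt_inv]; rfl⟩
        ⟨by rw [g.map_src], by rw [g.map_tgt]; rfl⟩
      have h2 : Z.Homotopic (g.onVert (Y.tgt d)) (g.onVert (Y.tgt e))
          [g.onDart (Y.inv d), g.onDart e] [] := by
        have := homotopic_backtrack (g.onDart (Y.inv d))
        have hv : g.onVert (Y.tgt d) = g.onVert (Y.tgt e) := by rw [← g.map_tgt, ← g.map_tgt, hd]
        rw [g.map_src, g.map_inv, Y.inv_inv, hd, src_inv, IsNullHomotopic] at this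
        rwa [← hv]
      simpa using h1.trans h2

/-- A map that is onto the `1`-skeleton is surjective on fundamental groups if identified `0`-cells
are joined by paths with null-homotopic image. -/
theorem Hom.isPiOneSurjective_of_surjective {Z : TwoComplex.{u}} (g : Hom Y Z)
    (hv : Function.Surjective g.onVert) (hd : Function.Surjective g.onDart)
    (hp : ∀ a b, g.onVert a = g.onVert b → ∃ p, Y.IsPath a p b ∧
      Z.Homotopic (g.onVert a) (g.onVert b) (p.map g.onDart) []) : g.IsPiOneSurjective := by
  have hs := Function.surjInv_eq hv
  refine g.isPiOneSurjective_of_connecting (Function.surjInv hv) (fun _ => []) hs ?_ ?_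
  · intro e
    obtain ⟨d, rfl⟩ := hd e
    obtain ⟨p, h1, h2⟩ := hp (Function.surjInv hv (Z.src (g.onDart d))) (Y.src d)
      (by rw [hs, g.map_src])
    obtain ⟨q, h3, h4⟩ := hp (Y.tgt d) (Function.surjInv hv (Z.tgt (g.onDart d)))
      (by rw [hs, g.map_tgt])
    refine ⟨p ++ [d] ++ q, (h1.append (isPath_singleton d)).append h3, ?_⟩
    rw [hs] at h4
    have h5 := (h2.append (.refl (g.isPath_map (isPath_singleton d)))).append h4
    simpa using h5.symm
  · intro y
    obtain ⟨p, h1, h2⟩ := hp y (Function.surjInv hv (g.onVert y)) (by rw [hs])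
    rw [hs] at h2
    refine ⟨p, h1, ?_⟩
    rw [List.append_nil]
    exact h2

section Action

variable {H : Type u} [Group H] [ComplexAction H X] [ComplexAction H Y]

theorem FoldRel.smul (hf : f.IsEquivariant H) (hr : ∀ (h : H) a b, r a b → r (h • a) (h • b))
    (h : H) {a b : Y.Vert} (hab : FoldRel f r a b) : FoldRel f r (h • a) (h • b) := by
  induction hab with
  | base a b hab => exact .base _ _ (hr h a b hab)
  | refl a => exact .refl _
  | symm a b _ ih => exact .symm _ _ ih
  | trans a b c _ _ ih ih' => exact .trans _ _ _ ih ih'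
  | fold d e hde _ ih =>
    rw [← smul_tgt, ← smul_tgt]
    refine .fold _ _ (by rw [hf.2.1, hf.2.1, hde]) ?_
    rwa [ComplexAction.smul_src, ComplexAction.smul_src]

/-- The action on the `0`-cells of the folded graph. -/
abbrev foldVertAction (hf : f.IsEquivariant H)
    (hr : ∀ (h : H) a b, r a b → r (h • a) (h • b)) : MulAction H (foldGraph f r).Vert where
  smul h := Quotient.map (h • ·) fun _ _ hab => FoldRel.smul hf hr h hab
  one_smul := by
    rintro ⟨a⟩
    exact congrArg (Quotient.mk _) (one_smul H a)
  mul_smul g h := by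
    rintro ⟨a⟩
    exact congrArg (Quotient.mk _) (mul_smul g h a)

/-- The action on the oriented edges of the folded graph. -/
abbrev foldDartAction (hf : f.IsEquivariant H)
    (hr : ∀ (h : H) a b, r a b → r (h • a) (h • b)) : MulAction H (foldGraph f r).Dart where
  smul h := Quotient.map (h • ·) fun d e hde => ⟨by rw [hf.2.1, hf.2.1, hde.1], by
    rw [ComplexAction.smul_src, ComplexAction.smul_src]
    exact FoldRel.smul hf hr h hde.2⟩
  one_smul := by
    rintro ⟨a⟩
    exact congrArg (Quotient.mk _) (one_smul H a)
  mul_smul g h := by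
    rintro ⟨a⟩
    exact congrArg (Quotient.mk _) (mul_smul g h a)

/-- If the boundary path of a `2`-cell of `X` lifts to a path in `Y`, then the `2`-cell can be lifted
in a finite extension. -/
theorem exists_extension_side_of_isPath (f : Hom Y X) (hf : f.IsEquivariant H) (a b : Y.Vert)
    (s : X.Side) {l : List Y.Dart} (hl : Y.IsPath a l b) (hs : l.map f.onDart = X.boundary s) :
    ∃ (Z : TwoComplex.{u}) (_ : ComplexAction H Z) (g : Hom Y Z) (k : Hom Z X),
      IsFiniteExtension H f g k ∧ ∃ t, Z.src (Z.edge t) = g.onVert a ∧ k.onSide t = s := by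
  -- The endpoints of `l` and of all its translates are identified, so that these paths close up.
  let r : Y.Vert → Y.Vert → Prop := fun x y => ∃ h : H, x = h • a ∧ y = h • b
  have hfa : X.src (X.edge s) = f.onVert a := by
    have h1 := f.isPath_map hl
    rw [hs, boundary_eq_cons] at h1
    exact h1.1
  have hab : f.onVert a = f.onVert b := by
    have h1 := f.isPath_map hl
    rw [hs] at h1
    have h2 := isPath_boundary s
    rw [hfa] at h2
    exact h2.target_unique h1
  have hr : ∀ x y, r x y → f.onVert x = f.onVert y := by
    rintro _ _ ⟨h, rfl, rfl⟩
    rw [hf.1, hf.1, hab]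
  have hrH : ∀ (h : H) x y, r x y → r (h • x) (h • y) := by
    rintro h _ _ ⟨g, rfl, rfl⟩
    exact ⟨h * g, smul_smul _ _ _, smul_smul _ _ _⟩
  let φ := foldDesc f r hr
  let M := liftedComplex φ
  let _ : MulAction H (foldGraph f r).Vert := foldVertAction hf hrH
  let _ : MulAction H (foldGraph f r).Dart := foldDartAction hf hrH
  let _ : ComplexAction H M := liftedComplexAction φ
    (by rintro h ⟨d⟩; exact congrArg (Quotient.mk _) (ComplexAction.smul_src h d))
    (by rintro h ⟨d⟩; exact congrArg (Quotient.mk _) (ComplexAction.smul_inv h d))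
    (by rintro h ⟨d⟩; exact hf.2.1 h d)
  let k : Hom M X := liftedComplexProj φ
  have hk : k.IsImmersion := liftedComplexProj_isImmersion φ (foldDesc_injective f r hr)
  have hkH : k.IsEquivariant H :=
    ⟨by rintro h ⟨v⟩; exact hf.1 h v, by rintro h ⟨d⟩; exact hf.2.1 h d, fun _ _ => rfl⟩
  let g : Hom Y M := liftedComplexLift φ f (foldMk f r) fun _ => rfl
  have hgH : g.IsEquivariant H :=
    ⟨fun _ _ => rfl, fun _ _ => rfl, fun h t => LiftedSide.ext (funext fun i => by
      change Quotient.mk _ (Y.edge ((Y.next ^ i) (h • t))) =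
        Quotient.mk _ (h • (Y.edge ((Y.next ^ i) t)))
      rw [next_zpow_smul, ComplexAction.smul_edge]) (hf.2.2 h t)⟩
  have hgab : g.onVert a = g.onVert b := Quotient.sound (.base _ _ ⟨1, by simp, by simp⟩)
  -- The image of `l` is now a closed lift of the boundary path of `s`, and so bounds a `2`-cell of
  -- `M`.
  obtain ⟨σ, hσs, hσ⟩ : ∃ σ : M.Side, k.onSide σ = s ∧ M.src (M.edge σ) = g.onVert a := by
    refine LiftedSide.exists_of_isPath (φ := φ) s (l := l.map g.onDart) ?_ ?_
    · have := g.isPath_map hl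
      rwa [← hgab] at this
    · exact List.map_map.trans hs
  -- `M` contains all possible lifted cells, perhaps in infinitely many orbits. Only the images of
  -- cells of `Y` and the orbit of the new cell are kept.
  let K : Sub M :=
    { verts := Set.univ
      darts := Set.univ
      sides := {τ | (∃ t, g.onSide t = τ) ∨ ∃ h : H, M.SameCell (h • σ) τ}
      src_mem := fun _ _ => trivial
      inv_mem := fun _ _ => trivial
      edge_mem := fun _ _ => trivial
      next_mem := by
        rintro _ (⟨t, rfl⟩ | ⟨h, ht⟩)
        · exact .inl ⟨_, (g.map_next t).symm⟩
        · exact .inr ⟨h, ht.next⟩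
      rev_mem := by
        rintro _ (⟨t, rfl⟩ | ⟨h, ht⟩)
        · exact .inl ⟨_, (g.map_rev t).symm⟩
        · exact .inr ⟨h, ht.rev⟩ }
  let _ : ComplexAction H K.toComplex := K.action (fun _ _ _ => trivial) (fun _ _ _ => trivial) (by
    rintro h _ (⟨t, rfl⟩ | ⟨h', ht⟩)
    · exact .inl ⟨h • t, hgH.2.2 h t⟩
    · refine .inr ⟨h * h', ?_⟩
      rw [mul_smul]
      exact ht.smul h)
  let g' : Hom Y K.toComplex :=
    K.lift g (fun _ => trivial) (fun _ => trivial) (fun t => .inl ⟨t, rfl⟩)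
  have hg'H : g'.IsEquivariant H := ⟨fun h v => Subtype.ext (hgH.1 h v),
    fun h v => Subtype.ext (hgH.2.1 h v), fun h v => Subtype.ext (hgH.2.2 h v)⟩
  have hv : Function.Surjective g'.onVert := by
    rintro ⟨⟨v⟩, -⟩
    exact ⟨v, rfl⟩
  have hd : Function.Surjective g'.onDart := by
    rintro ⟨⟨v⟩, -⟩
    exact ⟨v, rfl⟩
  have hk' : (K.incl.comp k).IsImmersion := K.incl_comp_isImmersion hk
  have hk'H : (K.incl.comp k).IsEquivariant H :=
    ⟨fun h v => hkH.1 h v.1, fun h v => hkH.2.1 h v.1, fun h v => hkH.2.2 h v.1⟩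
  let τ : K.toComplex.Side := ⟨σ, .inr ⟨1, by rw [one_smul]; exact .refl _⟩⟩
  refine ⟨K.toComplex, inferInstance, g', K.incl.comp k, ⟨hg'H, hk'H, rfl, ?_, hk', .of_surjective hv,
    .of_surjective hd, ?_⟩, τ, Subtype.ext hσ, hσs⟩
  -- For each generating identification, the two vertices are joined by a translate of `l`. By
  -- unique lifting its image is the boundary path of a translate of the new cell, hence
  -- null-homotopic.
  · refine g'.isPiOneSurjective_of_surjective hv hd fun x y hxy => ?_
    refine FoldRel.exists_path g' (fun d e h h' => Subtype.ext (Quotient.sound ⟨h, h'⟩)) ?_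
      (Quotient.exact (congrArg Subtype.val hxy) : FoldRel f r x y)
    rintro _ _ ⟨h, rfl, rfl⟩
    have hp := isPath_smul h hl
    refine ⟨l.map (h • ·), hp, ?_⟩
    have h1 : (l.map (h • ·)).map g'.onDart = K.toComplex.boundary (h • τ) := by
      refine hk'.path_inj (g'.isPath_map hp) (w' := g'.onVert (h • a)) ?_ ?_
      · have h2 := isPath_boundary (h • τ)
        have h3 : K.toComplex.src (K.toComplex.edge (h • τ)) = g'.onVert (h • a) := by
          rw [ComplexAction.smul_edge, ComplexAction.smul_src, hg'H.1]
          exact congrArg (h • ·) (Subtype.ext hσ : _ = g'.onVert a)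
        rwa [h3] at h2
      · rw [← Hom.boundary_map, hk'H.2.2]
        have h4 : (K.incl.comp k).onSide τ = s := hσs
        rw [h4, boundary_smul, ← hs, List.map_map, List.map_map, List.map_map]
        exact List.map_congr_left fun d _ => hf.2.1 h d
    have h5 : g'.onVert (h • a) = g'.onVert (h • b) :=
      Subtype.ext (Quotient.sound (.base _ _ ⟨h, rfl, rfl⟩))
    rw [h1, ← h5]
    have h2 := homotopic_boundary (h • τ)
    have h3 : K.toComplex.src (K.toComplex.edge (h • τ)) = g'.onVert (h • a) := by
      rw [ComplexAction.smul_edge, ComplexAction.smul_src, hg'H.1]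
      exact congrArg (h • ·) (Subtype.ext hσ : _ = g'.onVert a)
    rwa [h3] at h2
  · refine ⟨{t | M.SameCell σ t.1}, (finite_sameCell σ).preimage Subtype.val_injective.injOn, ?_⟩
    rintro ⟨_, ⟨t, rfl⟩ | ⟨h, ht⟩⟩
    · exact .inl ⟨t, rfl⟩
    · refine .inr ⟨h, h⁻¹ • ⟨_, .inr ⟨h, ht⟩⟩, ?_, smul_inv_smul _ _⟩
      have := ht.smul h⁻¹
      rwa [inv_smul_smul] at this

/-- A `2`-cell can be lifted in a finite extension. -/
theorem exists_extension_side (f : Hom Y X) (hf : f.IsEquivariant H) (hi : f.IsImmersion)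
    (a : Y.Vert) (s : X.Side) (hs : X.src (X.edge s) = f.onVert a) :
    ∃ (Z : TwoComplex.{u}) (_ : ComplexAction H Z) (g : Hom Y Z) (k : Hom Z X),
      IsFiniteExtension H f g k ∧ ∃ t, Z.src (Z.edge t) = g.onVert a ∧ k.onSide t = s := by
  have h := isPath_boundary s
  rw [hs] at h
  obtain ⟨Z, _, g, k, hk, l, c, hl, hl'⟩ := exists_extension_path f hf hi a _ _ h
  obtain ⟨W, _, g', k', hk', t, ht, ht'⟩ :=
    exists_extension_side_of_isPath k hk.right_equivariant _ c s hl hl'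
  exact ⟨W, inferInstance, g.comp g', k', hk.trans hk', t, ht, ht'⟩

end Action

end Fold

end TwoComplex

namespace TwoComplex

open OrientedGraph

/-! ## Lifting homotopies -/

section LiftHomotopy

variable {H : Type u} [Group H] {X : TwoComplex.{u}} [ComplexAction H X]

/-- A homotopy can be lifted in a finite extension. -/
theorem exists_extension_homotopic {v w : X.Vert} {l l' : List X.Dart}
    (h : X.Homotopic v w l l') (Y : TwoComplex.{u}) [ComplexAction H Y] (f : Hom Y X)
    (hf : f.IsEquivariant H) (hi : f.IsImmersion) (a : Y.Vert) (ha : f.onVert a = v) :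
    ∃ (Z : TwoComplex.{u}) (_ : ComplexAction H Z) (g : Hom Y Z) (k : Hom Z X),
      IsFiniteExtension H f g k ∧ ∃ m m' c, Z.Homotopic (g.onVert a) c m m' ∧
        m.map k.onDart = l ∧ m'.map k.onDart = l' := by
  -- The statement is proved for all immersed `Y` at once: in a composite homotopy, the second part
  -- is lifted to the extension constructed for the first.
  revert Y
  refine h.induction (r := fun l l' => ∀ (Y : TwoComplex.{u}) [ComplexAction H Y] (f : Hom Y X)
    (_ : f.IsEquivariant H) (_ : f.IsImmersion) (a : Y.Vert) (_ : f.onVert a = v),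
    ∃ (Z : TwoComplex.{u}) (_ : ComplexAction H Z) (g : Hom Y Z) (k : Hom Z X),
      IsFiniteExtension H f g k ∧ ∃ m m' c, Z.Homotopic (g.onVert a) c m m' ∧
        m.map k.onDart = l ∧ m'.map k.onDart = l') ?_ ?_ ?_ ?_
  · rintro l l' hl hl' hs Y _ f hf hi a rfl
    rcases hs with ⟨l₁, l₂, d⟩ | ⟨l₁, l₂, s⟩
    -- The longer path is lifted here; since `k` is an immersion, the lift of a backtrack is a
    -- backtrack.
    · obtain ⟨Z, _, g, k, hk, m, c, hm, hm'⟩ := exists_extension_path f hf hi a _ _ hl'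
      refine ⟨Z, inferInstance, g, k, hk, ?_⟩
      obtain ⟨m₀, m₂, rfl, hm₀, rfl⟩ := List.map_eq_append_iff.1 hm'
      obtain ⟨m₁, m₃, rfl, rfl, hm₃⟩ := List.map_eq_append_iff.1 hm₀
      obtain ⟨e, m₄, rfl, rfl, hm₄⟩ := List.map_eq_cons_iff.1 hm₃
      obtain ⟨e', m₅, rfl, he', hm₅⟩ := List.map_eq_cons_iff.1 hm₄
      obtain rfl := List.map_eq_nil_iff.1 hm₅
      obtain ⟨y, h1, h2⟩ := isPath_append.1 hm
      obtain ⟨x, h3, rfl, h4, rfl⟩ := isPath_append.1 h1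
      obtain rfl : e' = Z.inv e := hk.immersion.dart_inj h4 (by rw [he', k.map_inv])
      rw [tgt_inv] at h2
      refine ⟨m₁ ++ m₂, _, c, .of_step (h3.append h2) hm (.backtrack m₁ m₂ e), by simp, hm'⟩
    -- Here the shorter path is lifted, because a lift of the boundary path need not be closed
    -- before the cell has been attached.
    · obtain ⟨Z, _, g, k, hk, m, c, hm, hm'⟩ := exists_extension_path f hf hi a _ _ hl
      obtain ⟨m₁, m₂, rfl, rfl, rfl⟩ := List.map_eq_append_iff.1 hm'
      obtain ⟨x, h1, h2⟩ := isPath_append.1 hm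
      have hx : X.src (X.edge s) = k.onVert x := by
        rw [List.append_assoc] at hl'
        obtain ⟨y, h3, h4⟩ := isPath_append.1 hl'
        have h5 := k.isPath_map h1
        rw [hk.fac_vert] at h5
        rw [boundary_eq_cons] at h4
        exact h4.1.trans (h3.target_unique h5)
      obtain ⟨W, _, g', k', hk', t, ht, rfl⟩ :=
        exists_extension_side k hk.right_equivariant hk.immersion x s hx
      have hb := isPath_boundary t
      rw [ht] at hb
      refine ⟨W, inferInstance, g.comp g', k', hk.trans hk', m₁.map g'.onDart ++ m₂.map g'.onDart,
        m₁.map g'.onDart ++ W.boundary t ++ m₂.map g'.onDart, g'.onVert c, ?_, ?_, ?_⟩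
      · exact .of_step ((g'.isPath_map h1).append (g'.isPath_map h2))
          (((g'.isPath_map h1).append hb).append (g'.isPath_map h2)) (.cell _ _ _)
      · rw [List.map_append, hk'.fac_path, hk'.fac_path]
      · rw [List.map_append, List.map_append, hk'.fac_path, hk'.fac_path, Hom.boundary_map]
  · rintro l hl Y _ f hf hi a rfl
    obtain ⟨Z, _, g, k, hk, m, c, hm, hm'⟩ := exists_extension_path f hf hi a _ _ hl
    exact ⟨Z, inferInstance, g, k, hk, m, m, c, .refl hm, hm', hm'⟩
  · intro l l' h Y _ f hf hi a ha
    obtain ⟨Z, _, g, k, hk, m, m', c, hm, h1, h2⟩ := h Y f hf hi a ha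
    exact ⟨Z, inferInstance, g, k, hk, m', m, c, hm.symm, h2, h1⟩
  · intro l l' l'' h h' Y _ f hf hi a ha
    obtain ⟨Z, _, g, k, hk, m, m', c, hm, rfl, rfl⟩ := h Y f hf hi a ha
    obtain ⟨W, _, g', k', hk', n, n', c', hn, h1, h2⟩ :=
      h' Z k hk.right_equivariant hk.immersion (g.onVert a) ((hk.fac_vert a).trans ha)
    have hmg := g'.homotopic_map hm
    -- The two lifts of the middle path start at the same vertex, so they coincide.
    obtain rfl : m'.map g'.onDart = n := hk'.immersion.path_inj hmg.2.1 hn.1 (by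
      rw [hk'.fac_path, h1])
    obtain rfl := hmg.2.1.target_unique hn.1
    exact ⟨W, inferInstance, g.comp g', k', hk.trans hk', m.map g'.onDart, n', _, hmg.trans hn,
      hk'.fac_path _, h2⟩

/-- A path in `Y` whose image in `X` is null-homotopic becomes null-homotopic in a finite
extension. -/
theorem exists_extension_isNullHomotopic {Y : TwoComplex.{u}} [ComplexAction H Y] (f : Hom Y X)
    (hf : f.IsEquivariant H) (hi : f.IsImmersion) {v w : Y.Vert} {l : List Y.Dart}
    (hl : Y.IsPath v l w) (h : X.IsNullHomotopic (f.onVert v) (l.map f.onDart)) :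
    ∃ (Z : TwoComplex.{u}) (_ : ComplexAction H Z) (g : Hom Y Z) (k : Hom Z X),
      IsFiniteExtension H f g k ∧ g.onVert v = g.onVert w ∧
        Z.IsNullHomotopic (g.onVert v) (l.map g.onDart) := by
  obtain ⟨Z, _, g, k, hk, m, m', c, hm, h1, h2⟩ := exists_extension_homotopic h Y f hf hi v rfl
  obtain rfl := List.map_eq_nil_iff.1 h2
  obtain rfl : g.onVert v = c := hm.2.1
  have hlg := g.isPath_map hl
  obtain rfl : l.map g.onDart = m := hk.immersion.path_inj hlg hm.1 (by rw [hk.fac_path, h1])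
  exact ⟨Z, inferInstance, g, k, hk, hm.1.target_unique hlg, hm⟩

end LiftHomotopy

end TwoComplex

namespace TwoComplex

open OrientedGraph

/-! ## Retractions of edge paths -/

section Retraction

variable {Z W : TwoComplex.{u}} {p : Z.Vert → W.Vert} {r : Z.Dart → List W.Dart}

/-- The pair `p`, `r` plays the role of a continuous map `Z → W` on the `1`-skeleton. It is not
combinatorial: an edge may go to a path of any length, including a constant one. -/
theorem isPath_flatMap (hr : ∀ e, W.IsPath (p (Z.src e)) (r e) (p (Z.tgt e))) {v w : Z.Vert}
    {l : List Z.Dart} (hl : Z.IsPath v l w) : W.IsPath (p v) (l.flatMap r) (p w) := by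
  induction l generalizing v with
  | nil => exact congrArg p hl
  | cons e l ih =>
    obtain ⟨rfl, hl⟩ := hl
    exact (hr e).append (ih hl)

theorem isNullHomotopic_flatMap_next (hr : ∀ e, W.IsPath (p (Z.src e)) (r e) (p (Z.tgt e)))
    {s : Z.Side}
    (h : W.IsNullHomotopic (p (Z.src (Z.edge s))) ((Z.boundary s).flatMap r)) :
    W.IsNullHomotopic (p (Z.src (Z.edge (Z.next s)))) ((Z.boundary (Z.next s)).flatMap r) := by
  have h1 : r (Z.edge s) ++ (Z.boundary (Z.next s)).flatMap r =
      (Z.boundary s).flatMap r ++ r (Z.edge s) := by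
    have := congrArg (List.flatMap r) (edge_cons_boundary_next s)
    simpa using this
  have h2 := isPath_flatMap hr (isPath_boundary (Z.next s))
  have h3 : Z.src (Z.edge (Z.next s)) = Z.tgt (Z.edge s) := Z.src_edge_next s
  rw [h3] at h2 ⊢
  refine .cancel_left (hr (Z.edge s)) h2 rfl ?_
  rw [h1]
  simpa using h.append (.refl (hr (Z.edge s)))

/-- The reversed boundary path is inverse to a shifted one. Since `r (Z.inv e)` inverts `r e` only
up to homotopy, the cancellation is done by induction on the path. -/
theorem isNullHomotopic_flatMap_rev (hr : ∀ e, W.IsPath (p (Z.src e)) (r e) (p (Z.tgt e)))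
    (hinv : ∀ e, W.IsNullHomotopic (p (Z.src e)) (r e ++ r (Z.inv e))) {s : Z.Side}
    (h : W.IsNullHomotopic (p (Z.src (Z.edge s))) ((Z.boundary s).flatMap r)) :
    W.IsNullHomotopic (p (Z.src (Z.edge (Z.rev s)))) ((Z.boundary (Z.rev s)).flatMap r) := by
  have key : ∀ (l : List Z.Dart) (v w : Z.Vert), Z.IsPath v l w →
      W.IsNullHomotopic (p v) (l.flatMap r ++ (Z.invPath l).flatMap r) := by
    intro l
    induction l with
    | nil => exact fun v w _ => .refl rfl
    | cons e l ih =>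
      rintro _ w ⟨rfl, hl⟩
      have h1 := hr (Z.inv e)
      rw [src_inv, tgt_inv] at h1
      have := (ih _ _ hl).append_both (hr e) h1
      simp only [List.append_nil] at this
      have h2 := this.trans (hinv e)
      rw [IsNullHomotopic]
      simpa using h2
  rw [boundary_rev]
  have h1 := isNullHomotopic_flatMap_next hr h
  have h2 : Z.src (Z.edge (Z.rev s)) = Z.src (Z.edge (Z.next s)) := by
    rw [Z.edge_rev, Z.src_edge_next]
  rw [h2]
  have h3 := isPath_flatMap hr (isPath_boundary (Z.next s)).inv
  have h4 := (h1.append (.refl h3)).symm.trans (key _ _ _ (isPath_boundary (Z.next s)))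
  rw [IsNullHomotopic]
  simpa using h4

/-- Extension over a `2`-cell therefore needs to be checked from one oriented side only. -/
theorem isNullHomotopic_flatMap_of_sameCell
    (hr : ∀ e, W.IsPath (p (Z.src e)) (r e) (p (Z.tgt e)))
    (hinv : ∀ e, W.IsNullHomotopic (p (Z.src e)) (r e ++ r (Z.inv e))) {s t : Z.Side}
    (hst : Z.SameCell s t)
    (h : W.IsNullHomotopic (p (Z.src (Z.edge s))) ((Z.boundary s).flatMap r)) :
    W.IsNullHomotopic (p (Z.src (Z.edge t))) ((Z.boundary t).flatMap r) :=
  SameCell.induction (p := fun t =>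
    W.IsNullHomotopic (p (Z.src (Z.edge t))) ((Z.boundary t).flatMap r)) hst h
    (fun _ => isNullHomotopic_flatMap_next hr) (fun _ => isNullHomotopic_flatMap_rev hr hinv)

/-- The hypotheses say that the map on the `1`-skeleton extends over the `2`-cells, so elementary
homotopies go to homotopies. -/
theorem homotopic_flatMap (hr : ∀ e, W.IsPath (p (Z.src e)) (r e) (p (Z.tgt e)))
    (hinv : ∀ e, W.IsNullHomotopic (p (Z.src e)) (r e ++ r (Z.inv e)))
    (hcell : ∀ s, W.IsNullHomotopic (p (Z.src (Z.edge s))) ((Z.boundary s).flatMap r))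
    {v w : Z.Vert} {l m : List Z.Dart} (h : Z.Homotopic v w l m) :
    W.Homotopic (p v) (p w) (l.flatMap r) (m.flatMap r) := by
  refine h.induction
    (r := fun l m => W.Homotopic (p v) (p w) (l.flatMap r) (m.flatMap r)) ?_ ?_ ?_ ?_
  · intro l m hl hm hs
    have key : ∀ (l₁ b l₂ : List Z.Dart), Z.IsPath v (l₁ ++ b ++ l₂) w →
        (∀ x y, Z.IsPath x b y → x = y ∧ W.IsNullHomotopic (p x) (b.flatMap r)) →
        W.Homotopic (p v) (p w) ((l₁ ++ l₂).flatMap r) ((l₁ ++ b ++ l₂).flatMap r) := by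
      intro l₁ b l₂ h hb
      obtain ⟨y, h1, h2⟩ := isPath_append.1 h
      obtain ⟨x, h3, h4⟩ := isPath_append.1 h1
      obtain ⟨rfl, h5⟩ := hb x y h4
      have := h5.append_both (isPath_flatMap hr h3) (isPath_flatMap hr h2)
      simpa using this.symm
    rcases hs with ⟨l₁, l₂, d⟩ | ⟨l₁, l₂, s⟩
    · refine key _ _ _ hm ?_
      rintro x y ⟨rfl, -, h⟩
      exact ⟨by simpa using h, by simpa using hinv d⟩
    · refine key _ _ _ hm fun x y hxy => ?_
      have h1 := isPath_boundary s
      obtain rfl : Z.src (Z.edge s) = x := by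
        rw [boundary_eq_cons] at hxy
        exact hxy.1
      exact ⟨h1.target_unique hxy, hcell s⟩
  · exact fun l hl => .refl (isPath_flatMap hr hl)
  · exact fun _ _ => .symm
  · exact fun _ _ _ => .trans

variable (ι : Hom W Z) {c : Set W.Vert}

theorem flatMap_map_eq_self (hc : ∀ e, W.src e ∈ c → r (ι.onDart e) = [e] ∧ W.tgt e ∈ c)
    {v w : W.Vert} {l : List W.Dart} (hv : v ∈ c) (hl : W.IsPath v l w) :
    w ∈ c ∧ (l.map ι.onDart).flatMap r = l := by
  induction l generalizing v with
  | nil =>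
    obtain rfl : v = w := hl
    exact ⟨hv, rfl⟩
  | cons e l ih =>
    obtain ⟨rfl, hl⟩ := hl
    obtain ⟨h1, h2⟩ := hc e hv
    obtain ⟨h3, h4⟩ := ih h2 hl
    refine ⟨h3, ?_⟩
    rw [List.map_cons, List.flatMap_cons, h1, h4]
    rfl

/-- On paths starting in `c` the map given by `p`, `r` is a left inverse of `ι`, so applying it to a
homotopy in `Z` gives one in `W`. Allowing a proper subset `c` leaves the map free to collapse other
components. -/
theorem homotopic_of_retraction (hr : ∀ e, W.IsPath (p (Z.src e)) (r e) (p (Z.tgt e)))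
    (hinv : ∀ e, W.IsNullHomotopic (p (Z.src e)) (r e ++ r (Z.inv e)))
    (hcell : ∀ s, W.IsNullHomotopic (p (Z.src (Z.edge s))) ((Z.boundary s).flatMap r))
    (hp : ∀ v ∈ c, p (ι.onVert v) = v)
    (hc : ∀ e, W.src e ∈ c → r (ι.onDart e) = [e] ∧ W.tgt e ∈ c)
    {v w : W.Vert} {l m : List W.Dart} (hv : v ∈ c) (hl : W.IsPath v l w) (hm : W.IsPath v m w)
    (h : Z.Homotopic (ι.onVert v) (ι.onVert w) (l.map ι.onDart) (m.map ι.onDart)) :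
    W.Homotopic v w l m := by
  have h1 := homotopic_flatMap hr hinv hcell h
  obtain ⟨hw, h2⟩ := flatMap_map_eq_self ι hc hv hl
  obtain ⟨-, h3⟩ := flatMap_map_eq_self ι hc hv hm
  rwa [h2, h3, hp v hv, hp w hw] at h1

/-- A map is faithful if it induces an injective map on homotopy classes of paths. -/
def Hom.IsFaithful : Prop := ∀ v w l m, W.IsPath v l w → W.IsPath v m w →
  Z.Homotopic (ι.onVert v) (ι.onVert w) (l.map ι.onDart) (m.map ι.onDart) → W.Homotopic v w l m

end Retraction

/-! ### Restricting extensions to faithful subcomplexes -/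

section Restrict

variable {H : Type u} [Group H] {X Y Z : TwoComplex.{u}}
  [ComplexAction H X] [ComplexAction H Y] [ComplexAction H Z]

theorem _root_.CofiniteRange.codRestrict {α β : Type*} [MulAction H β] {φ : α → β}
    (hφ : CofiniteRange H φ) {S : Set β} (hS : ∀ (g : H), ∀ b ∈ S, g • b ∈ S)
    (h : ∀ a, φ a ∈ S) :
    letI := MulAction.onSubset S hS
    CofiniteRange H fun a => (⟨φ a, h a⟩ : S) := by
  obtain ⟨F, hF, h1⟩ := hφ
  refine ⟨Subtype.val ⁻¹' F, hF.preimage Subtype.val_injective.injOn, fun b => ?_⟩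
  rcases h1 b.1 with ⟨a, ha⟩ | ⟨g, e, he, hb⟩
  · exact .inl ⟨a, Subtype.ext ha⟩
  · refine .inr ⟨g, ⟨e, ?_⟩, he, Subtype.ext hb⟩
    have := hS g⁻¹ b.1 b.2
    rwa [← hb, inv_smul_smul] at this

/-- A finite extension restricts to each faithful subcomplex that contains the image of `Y`. -/
theorem IsFiniteExtension.restrict {f : Hom Y X} {g : Hom Y Z} {k : Hom Z X}
    (h : IsFiniteExtension H f g k) (K : Sub Z) (hK : K.incl.IsFaithful)
    (hv : ∀ h : H, ∀ v ∈ K.verts, h • v ∈ K.verts)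
    (hd : ∀ h : H, ∀ v ∈ K.darts, h • v ∈ K.darts)
    (hs : ∀ h : H, ∀ v ∈ K.sides, h • v ∈ K.sides)
    (hgv : ∀ v, g.onVert v ∈ K.verts) (hgd : ∀ v, g.onDart v ∈ K.darts)
    (hgs : ∀ v, g.onSide v ∈ K.sides) :
    letI := K.action hv hd hs
    IsFiniteExtension H f (K.lift g hgv hgd hgs) (K.incl.comp k) := by
  let _ := K.action hv hd hs
  exact
  { left_equivariant := ⟨fun a b => Subtype.ext (h.left_equivariant.1 a b),
      fun a b => Subtype.ext (h.left_equivariant.2.1 a b),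
      fun a b => Subtype.ext (h.left_equivariant.2.2 a b)⟩
    right_equivariant := ⟨fun a b => h.right_equivariant.1 a b.1,
      fun a b => h.right_equivariant.2.1 a b.1, fun a b => h.right_equivariant.2.2 a b.1⟩
    fac := h.fac
    piOneSurjective := by
      intro x l hl
      obtain ⟨m, hm, hm'⟩ := h.piOneSurjective x _ (K.incl.isPath_map hl)
      refine ⟨m, hm, hK _ _ _ _ (Hom.isPath_map _ hm) hl ?_⟩
      rw [List.map_map]
      exact hm'
    immersion := K.incl_comp_isImmersion h.immersion
    cofinite_vert := h.cofinite_vert.codRestrict hv hgv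
    cofinite_dart := h.cofinite_dart.codRestrict hd hgd
    cofinite_side := h.cofinite_side.codRestrict hs hgs }

end Restrict

end TwoComplex

namespace TwoComplex

open OrientedGraph

/-! ## Collapsing free and isolated edges -/

section Collapse

variable (H : Type u) [Group H] {Z : TwoComplex.{u}} [ComplexAction H Z]

/-- The oriented edges in the orbits of `d` and of its inverse. -/
def edgeOrbit (d : Z.Dart) : Set Z.Dart := {e | ∃ h : H, e = h • d ∨ Z.inv e = h • d}

variable {H}

theorem inv_mem_edgeOrbit {d e : Z.Dart} (he : e ∈ edgeOrbit H d) :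
    Z.inv e ∈ edgeOrbit H d := by
  obtain ⟨h, he | he⟩ := he
  · exact ⟨h, .inr (by rw [Z.inv_inv, he])⟩
  · exact ⟨h, .inl he⟩

theorem smul_mem_edgeOrbit (h : H) {d e : Z.Dart} (he : e ∈ edgeOrbit H d) :
    h • e ∈ edgeOrbit H d := by
  obtain ⟨g, he | he⟩ := he
  · exact ⟨h * g, .inl (by rw [mul_smul, he])⟩
  · exact ⟨h * g, .inr (by rw [mul_smul, ComplexAction.smul_inv, he])⟩

variable (H) in
/-- The subcomplex obtained by removing the orbit of an edge, together with all `2`-cells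
containing an edge of this orbit. -/
def removeEdge (d : Z.Dart) : Sub Z where
  verts := Set.univ
  darts := {e | e ∉ edgeOrbit H d}
  sides := {s | ∀ t, Z.SameCell s t → Z.edge t ∉ edgeOrbit H d}
  src_mem _ _ := trivial
  inv_mem e he he' := he (by
    have := inv_mem_edgeOrbit he'
    rwa [Z.inv_inv] at this)
  edge_mem s hs := hs s (.refl s)
  next_mem s hs t ht := hs t ((SameCell.refl s).next.trans ht)
  rev_mem s hs t ht := hs t ((SameCell.refl s).rev.trans ht)

theorem removeEdge_smul_darts (d : Z.Dart) (h : H) (e : Z.Dart)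
    (he : e ∈ (removeEdge H d).darts) : h • e ∈ (removeEdge H d).darts := fun he' => he (by
  have := smul_mem_edgeOrbit h⁻¹ he'
  rwa [inv_smul_smul] at this)

theorem removeEdge_smul_sides (d : Z.Dart) (h : H) (s : Z.Side)
    (hs : s ∈ (removeEdge H d).sides) : h • s ∈ (removeEdge H d).sides := fun t ht ht' => by
  have h1 := ht.smul h⁻¹
  rw [inv_smul_smul] at h1
  refine hs _ h1 ?_
  rw [ComplexAction.smul_edge]
  exact smul_mem_edgeOrbit _ ht'

open Classical in
/-- A criterion for the faithfulness of the inclusion of `removeEdge H d` on paths starting in a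
union of components: it suffices to replace the removed edges by paths in such a way that the
boundary paths of the removed cells become null-homotopic. -/
theorem removeEdge_homotopic (d : Z.Dart) (p : Z.Vert → (removeEdge H d).toComplex.Vert)
    (c : Set (removeEdge H d).toComplex.Vert) (hpc : ∀ v ∈ c, p v.1 = v)
    (hc : ∀ e, (removeEdge H d).toComplex.src e ∈ c ↔ (removeEdge H d).toComplex.tgt e ∈ c)
    (hpc' : ∀ v w, v ∉ c → w ∉ c → p v.1 = p w.1)
    (hA : ∀ h : H, ∃ q,
      (removeEdge H d).toComplex.IsPath (p (Z.src (h • d))) q (p (Z.tgt (h • d))) ∧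
      ∀ u, Z.edge u = h • d → ∃ m x y, x ∈ c ∧ (removeEdge H d).toComplex.IsPath x m y ∧
        (removeEdge H d).toComplex.IsNullHomotopic (p (Z.src (h • d))) (q ++ m) ∧
        Z.boundary u = h • d :: m.map (removeEdge H d).incl.onDart)
    {v w : (removeEdge H d).toComplex.Vert} {l m : List (removeEdge H d).toComplex.Dart}
    (hv : v ∈ c) (hl : (removeEdge H d).toComplex.IsPath v l w)
    (hm : (removeEdge H d).toComplex.IsPath v m w)
    (h : Z.Homotopic v.1 w.1 (l.map (removeEdge H d).incl.onDart)
      (m.map (removeEdge H d).incl.onDart)) :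
    (removeEdge H d).toComplex.Homotopic v w l m := by
  let K := removeEdge H d
  let W := K.toComplex
  -- The replacement path must depend on the edge alone, and `h` is not determined by `h • d`; so
  -- the choice is indexed by the edge.
  have hA' : ∀ e : Z.Dart, (∃ h : H, e = h • d) → ∃ q,
      W.IsPath (p (Z.src e)) q (p (Z.tgt e)) ∧
      ∀ u, Z.edge u = e → ∃ m x y, x ∈ c ∧ W.IsPath x m y ∧
        W.IsNullHomotopic (p (Z.src e)) (q ++ m) ∧
        Z.boundary u = e :: m.map K.incl.onDart := by
    rintro _ ⟨h, rfl⟩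
    exact hA h
  choose A hA1 hA2 using hA'
  -- Without inversions, each removed edge has exactly one orientation in the orbit of `d`, so the
  -- replacement of the other orientation can be defined as the inverse path.
  have hno : ∀ e : Z.Dart, (∃ h : H, e = h • d) → ¬ ∃ h : H, Z.inv e = h • d := by
    rintro _ ⟨h, rfl⟩ ⟨g, hg⟩
    rw [ComplexAction.smul_inv] at hg
    apply ComplexAction.smul_dart_ne_inv (h⁻¹ * g) d
    rw [mul_smul, ← hg, inv_smul_smul]
  -- Kept edges in `c` are fixed, kept edges outside `c` are collapsed, and removed edges are
  -- replaced by the chosen paths or their inverses. The last `[]` is never reached.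
  let r : Z.Dart → List W.Dart := fun e =>
    if he : e ∈ K.darts then (if (⟨Z.src e, trivial⟩ : W.Vert) ∈ c then [⟨e, he⟩] else [])
    else if h : ∃ h : H, e = h • d then A e h
    else if h : ∃ h : H, Z.inv e = h • d then W.invPath (A (Z.inv e) h) else []
  have r1 : ∀ (e : Z.Dart) (he : e ∈ K.darts), (⟨Z.src e, trivial⟩ : W.Vert) ∈ c →
      r e = [⟨e, he⟩] := fun e he h => by simp only [r, dif_pos he, if_pos h]
  have r2 : ∀ (e : Z.Dart) (he : e ∈ K.darts), (⟨Z.src e, trivial⟩ : W.Vert) ∉ c →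
      r e = [] := fun e he h => by simp only [r, dif_pos he, if_neg h]
  have r3 : ∀ (e : Z.Dart) (he : ∃ h : H, e = h • d), r e = A e he := fun e he => by
    have : e ∉ K.darts := fun h' => h' ⟨he.choose, .inl he.choose_spec⟩
    simp only [r, dif_neg this, dif_pos he]
  have r4 : ∀ (e : Z.Dart) (he : ∃ h : H, Z.inv e = h • d),
      r e = W.invPath (A (Z.inv e) he) := fun e he => by
    have h1 : e ∉ K.darts := fun h' => h' ⟨he.choose, .inr he.choose_spec⟩
    have h2 : ¬ ∃ h : H, e = h • d := fun h' => hno e h' he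
    simp only [r, dif_neg h1, dif_neg h2, dif_pos he]
  have hcases : ∀ e : Z.Dart, e ∈ K.darts ∨ (∃ h : H, e = h • d) ∨ ∃ h : H, Z.inv e = h • d := by
    intro e
    by_cases he : e ∈ K.darts
    · exact .inl he
    · obtain ⟨h, he | he⟩ := not_not.1 he
      · exact .inr (.inl ⟨h, he⟩)
      · exact .inr (.inr ⟨h, he⟩)
  have hr : ∀ e, W.IsPath (p (Z.src e)) (r e) (p (Z.tgt e)) := by
    intro e
    rcases hcases e with he | he | he
    · have hce := hc ⟨e, he⟩
      by_cases hs : (⟨Z.src e, trivial⟩ : W.Vert) ∈ c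
      · rw [r1 e he hs]
        exact ⟨(hpc _ hs).symm, (hpc _ (hce.1 hs)).symm⟩
      · rw [r2 e he hs]
        exact hpc' _ _ hs fun h => hs (hce.2 h)
    · rw [r3 e he]
      exact hA1 e he
    · rw [r4 e he]
      have := (hA1 _ he).inv
      rwa [tgt_inv, src_inv] at this
  have hinv : ∀ e, W.IsNullHomotopic (p (Z.src e)) (r e ++ r (Z.inv e)) := by
    intro e
    rcases hcases e with he | he | he
    · have hce := hc ⟨e, he⟩
      have he' := K.inv_mem e he
      by_cases hs : (⟨Z.src e, trivial⟩ : W.Vert) ∈ c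
      · rw [r1 e he hs, r1 _ he' (hce.1 hs)]
        have := homotopic_backtrack (C := W) ⟨e, he⟩
        have h1 : p (Z.src e) = ⟨Z.src e, trivial⟩ := hpc _ hs
        rw [h1]
        exact this
      · rw [r2 e he hs, r2 _ he' fun h => hs (hce.2 h)]
        exact .refl rfl
    · have he' : ∃ h : H, Z.inv (Z.inv e) = h • d := by rwa [Z.inv_inv]
      rw [r3 e he, r4 _ he']
      simp only [Z.inv_inv]
      exact append_invPath (hA1 e he)
    · rw [r4 e he, r3 _ he]
      have := invPath_append (hA1 _ he)
      rwa [tgt_inv] at this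
  have hcr : ∀ e, W.src e ∈ c → r (K.incl.onDart e) = [e] ∧ W.tgt e ∈ c :=
    fun e he => ⟨r1 e.1 e.2 he, (hc e).1 he⟩
  have hout : ∀ (l : List W.Dart) (v w : W.Vert), v ∉ c → W.IsPath v l w →
      (l.map K.incl.onDart).flatMap r = [] := by
    intro l
    induction l with
    | nil => exact fun _ _ _ _ => rfl
    | cons e l ih =>
      rintro _ w hv ⟨rfl, hl⟩
      rw [List.map_cons, List.flatMap_cons, ih _ _ (fun h => hv ((hc e).2 h)) hl]
      exact (List.append_nil _).trans (r2 e.1 e.2 hv)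
  have hcell : ∀ s, W.IsNullHomotopic (p (Z.src (Z.edge s))) ((Z.boundary s).flatMap r) := by
    intro s
    by_cases hs : s ∈ K.sides
    · have h1 := isPath_boundary (C := W) ⟨s, hs⟩
      have h2 := K.incl.boundary_map ⟨s, hs⟩
      change Z.boundary s = _ at h2
      rw [h2]
      by_cases hsc : W.src (W.edge ⟨s, hs⟩) ∈ c
      · rw [(flatMap_map_eq_self K.incl hcr hsc h1).2]
        have h3 : p (Z.src (Z.edge s)) = W.src (W.edge ⟨s, hs⟩) := hpc _ hsc
        rw [h3]
        exact homotopic_boundary _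
      · rw [hout _ _ _ hsc h1]
        exact .refl rfl
    -- A removed cell has a side on a translate of `d`; reversing it if necessary gives the
    -- orientation for which the hypothesis is stated.
    · obtain ⟨u, h, hsu, hu⟩ : ∃ u, ∃ h : H, Z.SameCell s u ∧ Z.edge u = h • d := by
        simp only [K, removeEdge, Set.mem_ofPred_eq, not_forall, not_not] at hs
        obtain ⟨t, ht, h, he | he⟩ := hs
        · exact ⟨t, h, ht, he⟩
        · exact ⟨Z.rev t, h, ht.rev, by rw [Z.edge_rev, he]⟩
      refine isNullHomotopic_flatMap_of_sameCell hr hinv hsu.symm ?_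
      obtain ⟨m, x, y, hx, hm, hnull, hb⟩ := hA2 (h • d) ⟨h, rfl⟩ u hu
      rw [hb, hu, List.flatMap_cons, r3 _ ⟨h, rfl⟩, (flatMap_map_eq_self K.incl hcr hx hm).2]
      exact hnull
  exact homotopic_of_retraction K.incl hr hinv hcell hpc hcr hv hl hm h

/-- Removing an orbit of edges that are not contained in any `2`-cell is faithful. -/
theorem removeEdge_isFaithful_of_isolated (d : Z.Dart) (hd : ∀ s, Z.edge s ≠ d) :
    (removeEdge H d).incl.IsFaithful := by
  classical
  intro v w l m hl hm h
  let W := (removeEdge H d).toComplex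
  let c : Set W.Vert := {x | ∃ l, W.IsPath v l x}
  have hvc : v ∈ c := ⟨[], rfl⟩
  -- Deleting the edges may disconnect the complex. Everything outside the component of `v` is sent
  -- to `v`, and any path in that component may replace a removed edge, as there is no `2`-cell to
  -- respect.
  let p : Z.Vert → W.Vert := fun x => if (⟨x, trivial⟩ : W.Vert) ∈ c then ⟨x, trivial⟩ else v
  have hp : ∀ x, p x ∈ c := by
    intro x
    by_cases hx : (⟨x, trivial⟩ : W.Vert) ∈ c
    · rw [show p x = ⟨x, trivial⟩ from if_pos hx]
      exact hx
    · rw [show p x = v from if_neg hx]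
      exact hvc
  refine removeEdge_homotopic d p c (fun x hx => if_pos hx) ?_ ?_ ?_ hvc hl hm h
  · intro e
    constructor
    · rintro ⟨l, hl⟩
      exact ⟨l ++ [e], hl.append ⟨rfl, rfl⟩⟩
    · rintro ⟨l, hl⟩
      exact ⟨l ++ [W.inv e], hl.append ⟨rfl, tgt_inv e⟩⟩
  · intro x y hx hy
    exact (if_neg hx).trans (if_neg hy).symm
  · intro h
    obtain ⟨q, hq⟩ := hp (Z.src (h • d))
    obtain ⟨q', hq'⟩ := hp (Z.tgt (h • d))
    refine ⟨W.invPath q ++ q', hq.inv.append hq', fun u hu => (hd (h⁻¹ • u) ?_).elim⟩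
    rw [ComplexAction.smul_edge, hu, inv_smul_smul]

/-- Collapsing an orbit of `2`-cells through free faces is faithful. -/
theorem removeEdge_isFaithful_of_free (s : Z.Side) (hs : ∀ t, Z.edge t = Z.edge s → t = s) :
    (removeEdge H (Z.edge s)).incl.IsFaithful := by
  intro v w l m hl hm h
  let K := removeEdge H (Z.edge s)
  let W := K.toComplex
  have huniq : ∀ (h : H) u, Z.edge u = h • Z.edge s → u = h • s := by
    intro h u hu
    rw [← inv_smul_eq_iff]
    apply hs
    rw [ComplexAction.smul_edge, hu, inv_smul_smul]
  refine removeEdge_homotopic (Z.edge s) (fun x => ⟨x, trivial⟩) Set.univ (fun _ _ => rfl)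
    (fun _ => Iff.rfl) (fun _ _ h => (h trivial).elim) (fun h => ?_) trivial hl hm h
  have hb := isPath_boundary (h • s)
  rw [boundary_eq_cons] at hb
  obtain ⟨-, hb⟩ := hb
  -- The rest of the boundary avoids the removed orbit. Otherwise freeness would make another side
  -- of the same cell, up to reversal, a translate of `h • s`. An element carrying a cell to itself
  -- fixes its sides, so this side would equal `h • s`, against minimality of the period, or its
  -- reverse would, against `not_sameCycle_rev`.
  obtain ⟨hw, m, hm, hm'⟩ := K.exists_path hb trivial (by
    intro e he
    obtain ⟨i, hi, rfl⟩ := List.mem_map.1 he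
    rw [List.mem_range] at hi
    have hcyc : Z.next.SameCycle (h • s) ((Z.next ^ (i + 1)) (h • s)) :=
      ⟨(i + 1 : ℕ), by rw [zpow_natCast]⟩
    rintro ⟨g, hg⟩
    have hgh : (g * h⁻¹) • h • s = g • s := by rw [smul_smul, inv_mul_cancel_right]
    rcases hg with hg | hg
    · have h1 := huniq g _ hg
      rw [h1, ← hgh] at hcyc
      have h2 := ComplexAction.smul_side_eq _ _ (.inl hcyc)
      rw [hgh, ← h1, ← Equiv.Perm.iterate_eq_pow] at h2
      exact Function.not_isPeriodicPt_of_pos_of_lt_minimalPeriod (by omega) (by omega) h2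
    · rw [← Z.edge_rev] at hg
      have h1 := huniq g _ hg
      have h3 : Z.SameCell (h • s) (g • s) := by
        rw [← h1]
        exact SameCell.rev (.inl hcyc)
      rw [← hgh] at h3
      have h2 := ComplexAction.smul_side_eq _ _ h3
      rw [hgh, ← h1] at h2
      apply Z.not_sameCycle_rev ((Z.next ^ (i + 1)) (h • s))
      rw [h2]
      exact hcyc.symm)
  have he : Z.edge (h • s) = h • Z.edge s := ComplexAction.smul_edge h s
  -- The free edge is pushed across its cell to the rest of the boundary, traversed backwards.
  refine ⟨W.invPath m, ?_, fun u hu => ⟨m, _, _, trivial, hm, ?_, ?_⟩⟩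
  · have := hm.inv
    simp only [he] at this
    exact this
  · have := invPath_append hm
    simp only [he] at this
    exact this
  · rw [huniq h u hu, boundary_eq_cons, hm', he]

end Collapse

end TwoComplex

namespace TwoComplex

open OrientedGraph

/-! ## The components that meet the image -/

section Components

variable {Y Z : TwoComplex.{u}} (g : Hom Y Z)

/-- The union of the components that meet the image of `g`. -/
def componentsOf : Sub Z where
  verts := {z | ∃ y l, Z.IsPath (g.onVert y) l z}
  darts := {e | ∃ y l, Z.IsPath (g.onVert y) l (Z.src e)}
  sides := {s | ∃ y l, Z.IsPath (g.onVert y) l (Z.src (Z.edge s))}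
  src_mem _ h := h
  inv_mem := by
    rintro e ⟨y, l, hl⟩
    exact ⟨y, l ++ [e], hl.append ⟨rfl, rfl⟩⟩
  edge_mem _ h := h
  next_mem := by
    rintro s ⟨y, l, hl⟩
    exact ⟨y, l ++ [Z.edge s], hl.append ⟨rfl, (Z.src_edge_next s).symm⟩⟩
  rev_mem := by
    rintro s ⟨y, l, hl⟩
    exact ⟨y, l ++ [Z.edge s], hl.append ⟨rfl, by rw [Z.edge_rev]; rfl⟩⟩

theorem mem_componentsOf_verts (y : Y.Vert) : g.onVert y ∈ (componentsOf g).verts :=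
  ⟨y, [], rfl⟩

theorem mem_componentsOf_darts (d : Y.Dart) : g.onDart d ∈ (componentsOf g).darts :=
  ⟨Y.src d, [], (g.map_src d).symm⟩

theorem mem_componentsOf_sides (s : Y.Side) : g.onSide s ∈ (componentsOf g).sides :=
  ⟨Y.src (Y.edge s), [], by rw [g.map_edge, g.map_src]; rfl⟩

-- The retraction sends all other components to the starting vertex `v` of the paths under
-- comparison.
open Classical in
theorem componentsOf_isFaithful : (componentsOf g).incl.IsFaithful := by
  intro v w l m hl hm h
  let K := componentsOf g
  let W := K.toComplex
  let p : Z.Vert → W.Vert := fun x => if hx : x ∈ K.verts then ⟨x, hx⟩ else v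
  let r : Z.Dart → List W.Dart := fun e => if he : e ∈ K.darts then [⟨e, he⟩] else []
  have p1 : ∀ x (hx : x ∈ K.verts), p x = ⟨x, hx⟩ := fun x hx => dif_pos hx
  have p2 : ∀ x (_ : x ∉ K.verts), p x = v := fun x hx => dif_neg hx
  have r1 : ∀ e (he : e ∈ K.darts), r e = [⟨e, he⟩] := fun x hx => dif_pos hx
  have r2 : ∀ e (_ : e ∉ K.darts), r e = [] := fun x hx => dif_neg hx
  have hinv' : ∀ e ∉ K.darts, Z.inv e ∉ K.darts := fun e he he' => he (by
    have := K.inv_mem _ he'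
    rwa [Z.inv_inv] at this)
  have hout : ∀ (l : List Z.Dart) (x y : Z.Vert), x ∉ K.verts → Z.IsPath x l y →
      l.flatMap r = [] := by
    intro l
    induction l with
    | nil => exact fun _ _ _ _ => rfl
    | cons e l ih =>
      rintro _ y hx ⟨rfl, hl⟩
      rw [List.flatMap_cons, r2 e hx, ih _ _ (hinv' e hx) hl, List.append_nil]
  refine homotopic_of_retraction (p := p) (r := r) (c := Set.univ) K.incl ?_ ?_ ?_
    (fun x _ => p1 _ x.2) (fun e _ => ⟨r1 _ e.2, trivial⟩) trivial hl hm h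
  · intro e
    by_cases he : e ∈ K.darts
    · rw [r1 e he, p1 _ (K.src_mem e he), p1 (Z.tgt e) (K.src_mem _ (K.inv_mem e he))]
      exact ⟨rfl, rfl⟩
    · rw [r2 e he, p2 _ he, p2 (Z.tgt e) (hinv' e he)]
      rfl
  · intro e
    by_cases he : e ∈ K.darts
    · rw [r1 e he, r1 _ (K.inv_mem e he), p1 _ (K.src_mem e he)]
      exact homotopic_backtrack (C := W) ⟨e, he⟩
    · rw [r2 e he, r2 _ (hinv' e he)]
      exact .refl rfl
  · intro s
    by_cases hs : s ∈ K.sides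
    · have h2 := K.incl.boundary_map ⟨s, hs⟩
      change Z.boundary s = _ at h2
      rw [h2, (flatMap_map_eq_self (c := Set.univ) K.incl (fun e _ => ⟨r1 _ e.2, trivial⟩) trivial
        (isPath_boundary (C := W) ⟨s, hs⟩)).2, p1 _ hs]
      exact homotopic_boundary (C := W) ⟨s, hs⟩
    · rw [hout _ _ _ hs (isPath_boundary s)]
      exact .refl rfl

theorem componentsOf_isConnected (hY : Y.IsConnected) :
    (componentsOf g).toComplex.IsConnected := by
  let K := componentsOf g
  let g' : Hom Y K.toComplex := K.lift g (mem_componentsOf_verts g) (mem_componentsOf_darts g)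
    (mem_componentsOf_sides g)
  have key : ∀ v : K.toComplex.Vert, ∃ y l, K.toComplex.IsPath (g'.onVert y) l v := by
    have hmem : ∀ (l : List Z.Dart) (x y : Z.Vert), x ∈ K.verts → Z.IsPath x l y →
        ∀ d ∈ l, d ∈ K.darts := by
      intro l
      induction l with
      | nil => simp
      | cons e l ih =>
        rintro _ y hx ⟨rfl, hl⟩ d hd
        rcases List.mem_cons.1 hd with rfl | hd
        · exact hx
        · exact ih _ _ (K.src_mem _ (K.inv_mem e hx)) hl d hd
    rintro ⟨z, y, l, hl⟩
    have hy := mem_componentsOf_verts g y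
    obtain ⟨_, m, hm, -⟩ := K.exists_path hl hy (hmem l _ _ hy hl)
    exact ⟨y, m, hm⟩
  obtain ⟨⟨y₀⟩, hY⟩ := hY
  refine ⟨⟨g'.onVert y₀⟩, fun v w => ?_⟩
  obtain ⟨y, l, hl⟩ := key v
  obtain ⟨y', l', hl'⟩ := key w
  obtain ⟨m, hm⟩ := hY y y'
  exact ⟨_, (hl.inv.append (g'.isPath_map hm)).append hl'⟩

variable {H : Type u} [Group H] [ComplexAction H Y] [ComplexAction H Z] {g}

theorem componentsOf_smul (hg : g.IsEquivariant H) (h : H) (v : Z.Vert)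
    (hv : v ∈ (componentsOf g).verts) : h • v ∈ (componentsOf g).verts := by
  obtain ⟨y, l, hl⟩ := hv
  refine ⟨h • y, l.map (h • ·), ?_⟩
  rw [hg.1]
  exact isPath_smul h hl

end Components

/-! ## Boundary and isolated orbits -/

section Boundary

variable {H : Type u} [Group H] {X Y Z : TwoComplex.{u}}
  [ComplexAction H X] [ComplexAction H Y] [ComplexAction H Z]

/-- The valence of `d` in the link is the number of sides glued to `d`. A single-vertex link or an
isolated vertex gives valence zero and a spur gives valence one; conversely, valence zero or one
gives an isolated vertex or a spur. -/
theorem mem_bnd_union_isolated {o : MulAction.orbitRel.Quotient H Z.Vert} :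
    o ∈ Z.bnd H ∪ Z.isolated H ↔ ∃ d : Z.Dart, Quotient.mk _ (Z.src d) = o ∧
      ∀ s t, Z.edge s = d → Z.edge t = d → s = t := by
  have hval : ∀ d : Z.Dart, ((Z.link (Z.src d)).valence ⟨d, rfl⟩ ≤ 1 ↔
      ∀ s t, Z.edge s = d → Z.edge t = d → s = t) := by
    intro d
    refine Set.encard_le_one_iff.trans ?_
    constructor
    · intro h s t hs ht
      have := h ⟨s, by rw [hs]⟩ ⟨t, by rw [ht]⟩ (Subtype.ext hs) (Subtype.ext ht)
      exact congrArg Subtype.val this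
    · intro h s t hs ht
      exact Subtype.ext (h _ _ (congrArg Subtype.val hs) (congrArg Subtype.val ht))
  constructor
  · rintro (⟨x, hx, ⟨⟨⟨d, rfl⟩, -⟩, he⟩ | ⟨⟨s, rfl⟩, hs⟩⟩ | ⟨x, hx, ⟨d, rfl⟩, hd⟩)
    · exact ⟨d, hx, fun s t hs _ => (he.false ⟨s, by rw [hs]⟩).elim⟩
    · exact ⟨Z.edge s, hx, (hval _).1 hs.le⟩
    · exact ⟨d, hx, (hval _).1 (hd.le.trans zero_le_one)⟩
  · rintro ⟨d, rfl, hd⟩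
    by_cases h : ∃ s, Z.edge s = d
    · obtain ⟨s, rfl⟩ := h
      refine .inl ⟨_, rfl, .inr ⟨⟨s, rfl⟩, le_antisymm ((hval _).2 hd) ?_⟩⟩
      exact Set.one_le_encard_iff_nonempty.2 ⟨⟨s, rfl⟩, rfl⟩
    · refine .inr ⟨_, rfl, ⟨d, rfl⟩, ?_⟩
      exact Set.encard_eq_zero.2 (Set.eq_empty_iff_forall_notMem.2
        fun s hs => h ⟨s.1, congrArg Subtype.val hs⟩)

/-- If the edges outside the image of `Y` are contained in at least two sides of `2`-cells, then
there are no new boundary or isolated orbits. -/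
theorem IsFiniteExtension.mk_bnd_union_isolated_le {f : Hom Y X} {g : Hom Y Z} {k : Hom Z X}
    (h : IsFiniteExtension H f g k) (hf : f.IsImmersion)
    (hd : ∀ d, d ∉ Set.range g.onDart → ∃ s t, s ≠ t ∧ Z.edge s = d ∧ Z.edge t = d) :
    Cardinal.mk ↥(Z.bnd H ∪ Z.isolated H) ≤ Cardinal.mk ↥(Y.bnd H ∪ Y.isolated H) := by
  let ψ : MulAction.orbitRel.Quotient H Y.Vert → MulAction.orbitRel.Quotient H Z.Vert :=
    Quotient.map g.onVert (by
      rintro a b ⟨c, rfl⟩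
      exact ⟨c, (h.left_equivariant.1 c b).symm⟩)
  refine (Cardinal.mk_le_mk_of_subset (t := ψ '' (Y.bnd H ∪ Y.isolated H)) ?_).trans
    Cardinal.mk_image_le
  intro o ho
  obtain ⟨d, rfl, hd'⟩ := mem_bnd_union_isolated.1 ho
  by_cases hr : d ∈ Set.range g.onDart
  · obtain ⟨e, rfl⟩ := hr
    refine ⟨Quotient.mk _ (Y.src e), mem_bnd_union_isolated.2 ⟨e, rfl, fun s t hs ht => ?_⟩,
      congrArg (Quotient.mk _) (g.map_src e).symm⟩
    -- Two sides at `e` with the same image in `Z` have the same image in `X`, and so coincide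
    -- because `f` is an immersion.
    refine hf.side_inj (by rw [hs, ht]) ?_
    rw [← h.fac_side, ← h.fac_side,
      hd' (g.onSide s) (g.onSide t) (by rw [g.map_edge, hs]) (by rw [g.map_edge, ht])]
  · obtain ⟨s, t, hst, hs, ht⟩ := hd d hr
    exact (hst (hd' s t hs ht)).elim

theorem IsFiniteExtension.isCocompact {f : Hom Y X} {g : Hom Y Z} {k : Hom Z X}
    (h : IsFiniteExtension H f g k) (hY : Y.IsCocompact H) : Z.IsCocompact H := by
  obtain ⟨_, _, _⟩ := hY
  exact ⟨CofiniteRange.finite_quotient h.cofinite_vert h.left_equivariant.1,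
    CofiniteRange.finite_quotient h.cofinite_dart h.left_equivariant.2.1,
    CofiniteRange.finite_quotient h.cofinite_side h.left_equivariant.2.2⟩

end Boundary

/-! ## Minimal extensions -/

section Minimal

variable {H : Type u} [Group H] {X Y : TwoComplex.{u}} [ComplexAction H X] [ComplexAction H Y]

/-- A path that becomes null-homotopic in some finite extension becomes null-homotopic in a finite
extension in which each new edge is contained in at least two sides of `2`-cells. -/
theorem exists_extension_thick (f : Hom Y X) {v w : Y.Vert} {l : List Y.Dart}
    (hl : Y.IsPath v l w)
    (h : ∃ (Z : TwoComplex.{u}) (_ : ComplexAction H Z) (g : Hom Y Z) (k : Hom Z X),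
      IsFiniteExtension H f g k ∧ g.onVert v = g.onVert w ∧
        Z.IsNullHomotopic (g.onVert v) (l.map g.onDart)) :
    ∃ (Z : TwoComplex.{u}) (_ : ComplexAction H Z) (g : Hom Y Z) (k : Hom Z X),
      IsFiniteExtension H f g k ∧ (g.onVert v = g.onVert w ∧
        Z.IsNullHomotopic (g.onVert v) (l.map g.onDart)) ∧
      ∀ d, d ∉ Set.range g.onDart → ∃ s t, s ≠ t ∧ Z.edge s = d ∧ Z.edge t = d := by
  classical
  -- The complexity to be minimized is the size of a finite set of edges whose translates cover all
  -- oriented edges outside the image of `Y`.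
  let p : ℕ → Prop := fun n =>
    ∃ (Z : TwoComplex.{u}) (_ : ComplexAction H Z) (g : Hom Y Z) (k : Hom Z X),
      IsFiniteExtension H f g k ∧ (g.onVert v = g.onVert w ∧
        Z.IsNullHomotopic (g.onVert v) (l.map g.onDart)) ∧
      ∃ F : Set Z.Dart, F.Finite ∧ F.ncard = n ∧
        ∀ d, d ∈ Set.range g.onDart ∨ ∃ h : H, ∃ e ∈ F, h • e = d
  have hp : ∃ n, p n := by
    obtain ⟨Z, _, g, k, hk, h1, h2⟩ := h
    obtain ⟨F, hF, hF'⟩ := hk.cofinite_dart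
    exact ⟨_, Z, inferInstance, g, k, hk, ⟨h1, h2⟩, F, hF, rfl, hF'⟩
  obtain ⟨Z, _, g, k, hk, hnull, F, hF, hcard, hcov⟩ := Nat.find_spec hp
  refine ⟨Z, inferInstance, g, k, hk, hnull, fun d hd => ?_⟩
  -- A new edge on at most one side could be removed with its orbit, which would lower the
  -- complexity.
  by_contra! hst
  let K := removeEdge H d
  have hK : K.incl.IsFaithful := by
    by_cases hs : ∃ s, Z.edge s = d
    · obtain ⟨s, rfl⟩ := hs
      refine removeEdge_isFaithful_of_free s fun t ht => ?_
      by_contra hne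
      exact hst t s hne ht rfl
    · exact removeEdge_isFaithful_of_isolated d fun s hs' => hs ⟨s, hs'⟩
  have hgd : ∀ e, g.onDart e ∈ K.darts := by
    rintro e ⟨h, he | he⟩
    · exact hd ⟨h⁻¹ • e, by rw [hk.left_equivariant.2.1, he, inv_smul_smul]⟩
    · rw [g.map_inv] at he
      exact hd ⟨h⁻¹ • Y.inv e, by rw [hk.left_equivariant.2.1, he, inv_smul_smul]⟩
  have hgs : ∀ s, g.onSide s ∈ K.sides := by
    intro s t ht
    obtain ⟨u, rfl⟩ : ∃ u, g.onSide u = t :=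
      SameCell.induction (p := fun t => ∃ u, g.onSide u = t) ht ⟨s, rfl⟩
        (by rintro _ ⟨u, rfl⟩; exact ⟨_, (g.map_next u).symm⟩)
        (by rintro _ ⟨u, rfl⟩; exact ⟨_, (g.map_rev u).symm⟩)
    rw [g.map_edge]
    exact hgd _
  let _ : ComplexAction H K.toComplex := K.action (fun _ _ _ => trivial)
    (removeEdge_smul_darts d) (removeEdge_smul_sides d)
  have hr := hk.restrict K hK (fun _ _ _ => trivial) (removeEdge_smul_darts d)
    (removeEdge_smul_sides d) (fun _ => trivial) hgd hgs
  obtain ⟨h₀, e₀, he₀, hde⟩ := (hcov d).resolve_left hd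
  have he₀' : e₀ ∉ K.darts := not_not.2 ⟨h₀⁻¹, .inl (by rw [← hde, inv_smul_smul])⟩
  -- The representative `e₀` of the orbit of `d` has been removed, so the covering set loses at
  -- least one element.
  have hlt : (Subtype.val ⁻¹' F : Set K.darts).ncard < Nat.find hp := by
    rw [← hcard, ← Set.ncard_image_of_injective _ Subtype.val_injective]
    refine Set.ncard_lt_ncard ?_ hF
    rw [Set.ssubset_iff_of_subset (Set.image_preimage_subset _ _)]
    refine ⟨e₀, he₀, ?_⟩
    rintro ⟨e, -, rfl⟩
    exact he₀' e.2
  refine Nat.find_min hp hlt ⟨K.toComplex, inferInstance, _, _, hr, ⟨Subtype.ext hnull.1, ?_⟩,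
    Subtype.val ⁻¹' F, hF.preimage Subtype.val_injective.injOn, rfl, fun e => ?_⟩
  · have hlg := (K.lift g (fun _ => trivial) hgd hgs).isPath_map hl
    have hvw : (K.lift g (fun _ => trivial) hgd hgs).onVert v =
      (K.lift g (fun _ => trivial) hgd hgs).onVert w := Subtype.ext hnull.1
    rw [← hvw] at hlg
    refine hK _ _ _ _ hlg rfl ?_
    rw [List.map_map]
    exact hnull.2
  · rcases hcov e.1 with ⟨b, hb⟩ | ⟨h, b, hb, hbe⟩
    · exact .inl ⟨b, Subtype.ext hb⟩
    · refine .inr ⟨h, ⟨b, ?_⟩, hb, Subtype.ext hbe⟩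
      have := removeEdge_smul_darts _ h⁻¹ e.1 e.2
      rwa [← hbe, inv_smul_smul] at this

end Minimal

end TwoComplex

/-! ### Proof of the theorem -/

open TwoComplex in
theorem mainTheorem9 {H : Type u} [Group H] (X Y : TwoComplex.{u})
    [ComplexAction H X] [ComplexAction H Y] (hX : X.IsSimplyConnected)
    (f : TwoComplex.Hom Y X) (hf : f.IsEquivariant H) (hfi : f.IsImmersion)
    (v w : Y.Vert) (P : List Y.Dart) (hP : Y.IsPath v P w) (hess : Y.IsEssential v P)
    (hclosed : f.onVert v = f.onVert w) (hsimple : X.IsSimpleClosed (P.map f.onDart)) :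
    ∃ (Z : TwoComplex.{u}) (_ : ComplexAction H Z)
      (g : TwoComplex.Hom Y Z) (k : TwoComplex.Hom Z X),
      g.IsEquivariant H ∧ k.IsEquivariant H ∧ g.comp k = f ∧
      g.IsPiOneSurjective ∧ k.IsImmersion ∧
      g.onVert v = g.onVert w ∧ Z.IsNullHomotopic (g.onVert v) (P.map g.onDart) ∧
      (Y.IsConnected → Z.IsConnected) ∧
      (Y.IsCocompact H → Z.IsCocompact H) ∧
      Cardinal.mk ↥(Z.bnd H ∪ Z.isolated H) ≤ Cardinal.mk ↥(Y.bnd H ∪ Y.isolated H) := by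
  have hPf := f.isPath_map hP
  rw [← hclosed] at hPf
  obtain ⟨Z, _, g, k, hk, ⟨hvw, hnull⟩, hthick⟩ := exists_extension_thick f hP
    (exists_extension_isNullHomotopic (H := H) f hf hfi hP (hX.2 _ _ hPf))
  -- The minimal extension may have components that miss the image of `Y`; discarding them makes `K`
  -- connected when `Y` is.
  let K := componentsOf g
  have hgv := mem_componentsOf_verts g
  have hgd := mem_componentsOf_darts g
  have hgs := mem_componentsOf_sides g
  have hKf : K.incl.IsFaithful := componentsOf_isFaithful g
  have hKv := componentsOf_smul hk.left_equivariant
  have hKd : ∀ h : H, ∀ d ∈ K.darts, h • d ∈ K.darts := fun h d hd => by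
    have := hKv h _ hd
    rwa [← ComplexAction.smul_src] at this
  have hKs : ∀ h : H, ∀ s ∈ K.sides, h • s ∈ K.sides := fun h s hs => by
    have := hKv h _ hs
    rwa [← ComplexAction.smul_src, ← ComplexAction.smul_edge] at this
  let _ : ComplexAction H K.toComplex := K.action hKv hKd hKs
  let g' : TwoComplex.Hom Y K.toComplex := K.lift g hgv hgd hgs
  have hr : IsFiniteExtension H f g' (K.incl.comp k) :=
    hk.restrict K hKf hKv hKd hKs hgv hgd hgs
  have hvw' : g'.onVert v = g'.onVert w := Subtype.ext hvw
  refine ⟨K.toComplex, inferInstance, g', K.incl.comp k, hr.left_equivariant,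
    hr.right_equivariant, hr.fac, hr.piOneSurjective, hr.immersion, hvw', ?_,
    componentsOf_isConnected g, hr.isCocompact, hr.mk_bnd_union_isolated_le hfi ?_⟩
  · have hlg := g'.isPath_map hP
    rw [← hvw'] at hlg
    refine hKf _ _ _ _ hlg rfl ?_
    rw [List.map_map]
    exact hnull
  · intro d hd
    obtain ⟨s, t, hst, hs, ht⟩ := hthick d.1 (by
      rintro ⟨e, he⟩
      exact hd ⟨e, Subtype.ext he⟩)
    -- A union of components contains every side glued to one of its edges, so new edges still lie
    -- on two sides.
    have hmem : ∀ s, Z.edge s = d.1 → s ∈ K.sides := fun s hs => by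
      have := d.2
      rw [← hs] at this
      exact this
    exact ⟨⟨s, hmem s hs⟩, ⟨t, hmem t ht⟩, fun h => hst (congrArg Subtype.val h),
      Subtype.ext hs, Subtype.ext ht⟩
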